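/- Let $K$ be a field of characteristic $0$ (for example $K=\mathbb{C}$, or $K=\mathbb{C}(P,Q)$ with $P,Q$ indeterminates), and let $P,Q\in K$ be nonzero. **Operators.** For functions of integer variables with values in $K$ let $E_x p(x)=p(x+1)$, $\Delta_x=E_x-\mathrm{id}$, ${}_P\Delta_x=P^{-x}\Delta_x$, ${}_PE_x={}_P\Delta_x+\mathrm{id}$, ${}_P^QE_x=Q\,\mathrm{id}+{}_P\Delta_x$ and ${}_P^Q\mathrm{id}_x=Q\,{}_PE_x-{}_P\Delta_x$. For $i<0$ put ${}_PE_x^{\,i}=\bigl(\sum_{j\ge 0}(-1)^j\,{}_P\Delta_x^{\,j}\bigr)^{-i}$, which is applied to functions annihilated by a power of ${}_P\Delta_x$. Let $\binom{x}{m}_P=\prod_{i=0}^{m-1}\frac{1-P^{x-i}}{1-P^{i+1}}$ be the $P$-binomial coefficient for $x\in\mathbb{Z}$, $m\ge 0$; it is a Laurent polynomial in $P$, and it is evaluated as such where the quotient is undefined (so it is the ordinary binomial coefficient $\binom{x}{m}$ for $P=1$). Sums over integers obey $\sum_{x=a}^{b}g(x)=-\sum_{x=b+1}^{a-1}g(x)$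 for $a>b$. **Recursion.** Let $S\subseteq\mathbb{Z}^2$ be finite and $f:S\to K$ (in particular $f:S\to\mathbb{C}$ if $\mathbb{C}\subseteq K$). The summation operator is defined by $\sum_{(l_1,\ldots,l_{n-1})}^{(k_1,\ldots,k_n)}A=0$ for $n=0$, $\sum_{(-)}^{(k_1)}A=A$ for $n=1$, and for $n\ge 2$ $$\sum_{(l_1,\ldots,l_{n-1})}^{(k_1,\ldots,k_n)}A(l_1,\ldots,l_{n-1})=\Bigl(Q^{-1}\,{}_P^QE_{k_n}\,{}_P^Q\mathrm{id}_{k^*_{n-1}}\sum_{l_{n-1}=k^*_{n-1}}^{k_n-1}P^{l_{n-1}}\sum_{(l_1,\ldots,l_{n-2})}^{(k_1,\ldots,k_{n-1})}A(l_1,\ldots,l_{n-1})$$ $$+\sum_{(l_1,\ldots,l_{n-3})}^{(k_1,\ldots,k_{n-2})}\ \sum_{(i,j)\in S}f(i,j)\,{}_PE_{k_{n-1}}^{\,i}\,{}_PE_{k^*_{n-1}}^{\,j}A(l_1,\ldots,l_{n-3},k_{n-1},k^*_{n-1})\Bigr)\Big|_{k^*_{n-1}=k_{n-1}}.$$ For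 $m\ge 0$ put $\alpha_{P,Q}(1,m,S,f;k_1)=\binom{k_1}{m}_P$ and, for $n\ge 2$, $$\alpha_{P,Q}(n,m,S,f;k_1,\ldots,k_n)=\sum_{(l_1,\ldots,l_{n-1})}^{(k_1,\ldots,k_n)}\alpha_{P,Q}(n-1,m,S,f;l_1,\ldots,l_{n-1}).$$ **Theorem.** Let $n\ge 1$ and $m\ge 0$ be integers, $S\subseteq\mathbb{Z}^2$ finite and $f:S\to K$. Then $\alpha_{P,Q}(n,m,S,f;\cdot)$ is well defined: in each variable it is annihilated by a power of the corresponding ${}_P\Delta$. With $$V_{s,t}={}_P^QE_{k_t}\;{}_P^Q\mathrm{id}_{k_s}-{}_P\Delta_{k_s}\,{}_P\Delta_{k_t}\sum_{(i,j)\in S}f(i,j)\,{}_PE_{k_t}^{\,i}\,{}_PE_{k_s}^{\,j}$$ and with the products of operators below taken as compositions in any order, the following hold for all $(k_1,\ldots,k_n)\in\mathbb{Z}^n$. 1. $$\alpha_{P,Q}(n,m,S,f;k_1,\ldots,k_n)=P^{\frac16(n-1)(n^2-2n+6m)}\,Q^{-\binom n2}\prod_{1\le s<t\le n}V_{s,t}\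 \det_{1\le i,j\le n}\binom{k_i}{j-1+\delta_{j,n}m}_P .$$ 2. For $m=0$, if $P^d\ne 1$ for $1\le d<n$, $$\alpha_{P,Q}(n,0,S,f;k_1,\ldots,k_n)=P^{\binom{n+1}{3}}\,Q^{-\binom n2}\prod_{1\le s<t\le n}V_{s,t}\ \prod_{1\le i<j\le n}\frac{P^{k_j}-P^{k_i}}{P^j-P^i};$$ for $P=1$ the same holds with the last product replaced by its limit $\prod_{1\le i<j\le n}\frac{k_j-k_i}{j-i}$. 3. In particular, for $P=Q=1$, $m=0$, $S=\{(0,0)\}$, $f(0,0)=-1$, $$\alpha_{1,1}(n,0,\{(0,0)\},-1;k_1,\ldots,k_n)=\prod_{1\le s<t\le n}\bigl(\mathrm{id}-E_{k_s}+E_{k_s}E_{k_t}\bigr)\prod_{1\le i<j\le n}\frac{k_j-k_i}{j-i},$$ and for $k_1<k_2<\cdots<k_n$ this is the number of monotone triangles with bottom row $(k_1,\ldots,k_n)$, i.e. of integer arrays $(a_{i,j})_{1\le i\le j\le n}$ with $a_{1,j}=k_j$, $a_{i,j}\le a_{i+1,j+1}$ for $1\le i\le j<n$, $a_{i,j}\le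 a_{i-1,j}$ for $1<i\le j\le n$, and $a_{i,j}<a_{i,j+1}$ for $1\le i\le j\le n-1$. -/

import Mathlib

noncomputable section

namespace OperatorFormula

variable {K : Type*} [Field K]

/-- The sum `∑_{x=a}^{b} g x` over integers, with the convention
`∑_{x=a}^{b} g x = - ∑_{x=b+1}^{a-1} g x` for `a > b`. -/
def signedSum (a b : ℤ) (g : ℤ → K) : K :=
  if a ≤ b then ∑ x ∈ Finset.Icc a b, g x else -∑ x ∈ Finset.Icc (b + 1) (a - 1), g x

theorem signedSum_telescope (g G : ℤ → K) (h0 : G 0 = 0) (h : ∀ x, G (x + 1) = G x + g x)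
    (x : ℤ) : signedSum 0 (x - 1) g = G x := by
  have pos : ∀ n : ℕ, ∑ y ∈ Finset.Icc (0 : ℤ) ((n : ℤ) - 1), g y = G n := by
    intro n
    induction n with
    | zero => simp [h0]
    | succ n ih =>
      have e : Finset.Icc (0 : ℤ) (((n + 1 : ℕ) : ℤ) - 1)
          = insert (n : ℤ) (Finset.Icc (0 : ℤ) ((n : ℤ) - 1)) := by
        ext y; simp only [Finset.mem_Icc, Finset.mem_insert]; push_cast; omega
      rw [e, Finset.sum_insert (by simp), ih]
      push_cast
      rw [h]; ring
  have neg : ∀ n : ℕ, ∑ y ∈ Finset.Icc (-(n : ℤ)) (-1), g y = -G (-(n : ℤ)) := by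
    intro n
    induction n with
    | zero => simp [h0]
    | succ n ih =>
      have e : Finset.Icc (-((n + 1 : ℕ) : ℤ)) (-1)
          = insert (-((n + 1 : ℕ) : ℤ)) (Finset.Icc (-(n : ℤ)) (-1)) := by
        ext y; simp only [Finset.mem_Icc, Finset.mem_insert]; push_cast; omega
      have hs := h (-((n + 1 : ℕ) : ℤ))
      have e2 : -((n + 1 : ℕ) : ℤ) + 1 = -(n : ℤ) := by push_cast; ring
      rw [e2] at hs
      rw [e, Finset.sum_insert (by simp), ih, hs]
      ring
  unfold signedSum
  split_ifs with hx
  · obtain ⟨n, rfl⟩ := Int.eq_ofNat_of_zero_le (show 0 ≤ x by omega)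
    exact pos n
  · obtain ⟨n, hn⟩ := Int.eq_ofNat_of_zero_le (show 0 ≤ -x by omega)
    obtain rfl : x = -(n : ℤ) := by omega
    have := neg n
    simp only [sub_add_cancel, zero_sub]
    rw [this, neg_neg]

/-- The `P`-binomial coefficient `[x choose m]_P` for `x : ℤ`. It is a Laurent polynomial in `P`,
and is defined here, for every nonzero `P`, by the `P`-Pascal recursion
`[x+1 choose m+1] - [x choose m+1] = P^(x-m) [x choose m]`, `[0 choose m+1] = 0`.
It is the usual quotient wherever the latter is defined (`pBinom_eq_div`), and it is the ordinary
binomial coefficient, the limit of the quotient, for `P = 1` (`pBinom_one`). -/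
def pBinom (P : K) (x : ℤ) : ℕ → K
  | 0 => 1
  | m + 1 => signedSum 0 (x - 1) fun l => P ^ (l - (m : ℤ)) * pBinom P l m

theorem pBinom_eq_div (P : K) (hP : P ≠ 0) (m : ℕ) (hm : ∀ d : ℕ, 0 < d → d ≤ m → P ^ d ≠ 1)
    (x : ℤ) : pBinom P x m
      = (∏ i ∈ Finset.range m, (1 - P ^ (x - i))) / ∏ i ∈ Finset.range m, (1 - P ^ (i + 1)) := by
  induction m generalizing x with
  | zero => simp [pBinom]
  | succ m ih =>
    have ih' := ih (fun d h1 h2 => hm d h1 (by omega))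
    rw [pBinom]
    refine signedSum_telescope _ (fun x => (∏ i ∈ Finset.range (m + 1), (1 - P ^ (x - (i : ℤ)))) /
      ∏ i ∈ Finset.range (m + 1), (1 - P ^ (i + 1))) ?_ ?_ x
    · simp [Finset.prod_range_succ']
    · intro y
      rw [ih' y]
      have hd : ∏ i ∈ Finset.range m, (1 - P ^ (i + 1)) ≠ 0 := by
        refine Finset.prod_ne_zero_iff.2 fun i hi => ?_
        rw [Finset.mem_range] at hi
        exact sub_ne_zero.2 (hm (i + 1) (by omega) (by omega)).symm
      have hd1 : (1 : K) - P ^ (m + 1) ≠ 0 := sub_ne_zero.2 (hm (m + 1) (by omega) le_rfl).symm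
      have e1 : ∏ i ∈ Finset.range (m + 1), (1 - P ^ (y + 1 - (i : ℤ)))
          = (∏ i ∈ Finset.range m, (1 - P ^ (y - (i : ℤ)))) * (1 - P ^ (y + 1)) := by
        rw [Finset.prod_range_succ']
        congr 1
        · refine Finset.prod_congr rfl fun i _ => ?_
          congr 2; push_cast; ring
        · simp
      have e2 : (P : K) ^ (y + 1) = P ^ (y - (m : ℤ)) * P ^ (m + 1) := by
        rw [← zpow_natCast, ← zpow_add₀ hP]
        congr 1; push_cast; ring
      rw [e1, Finset.prod_range_succ, Finset.prod_range_succ, e2]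
      field_simp
      ring

theorem pBinom_one (x : ℤ) (m : ℕ) : pBinom (1 : K) x m = ((Ring.choose x m : ℤ) : K) := by
  induction m generalizing x with
  | zero => simp [pBinom]
  | succ m ih =>
    rw [pBinom]
    refine signedSum_telescope _ (fun x => ((Ring.choose x (m + 1) : ℤ) : K)) ?_ ?_ x
    · simp [Ring.choose_zero_succ]
    · intro y
      rw [ih y, Ring.choose_succ_succ]
      push_cast
      simp [add_comm]

section Operators

variable {ι : Type*} [DecidableEq ι]

/-- The shift operator `E_{k_s}`. -/
def shift (s : ι) (F : (ι → ℤ) → K) : (ι → ℤ) → K :=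
  fun k => F (Function.update k s (k s + 1))

/-- The `P`-difference operator `P^{-k_s} (E_{k_s} - id)`. -/
def pDelta (P : K) (s : ι) (F : (ι → ℤ) → K) : (ι → ℤ) → K :=
  fun k => P ^ (-k s) * (shift s F k - F k)

/-- The `P`-shift operator. -/
def pShift (P : K) (s : ι) (F : (ι → ℤ) → K) : (ι → ℤ) → K :=
  pDelta P s F + F

/-- The inverse `P`-shift operator `∑_{j ≥ 0} (-1)^j Δ^j`, where `Δ` is the `P`-difference operator
in the variable `k_s`. It is meant for functions that are annihilated by a power of `Δ`, for which
the sum is finite. -/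
def pShiftInv (P : K) (s : ι) (F : (ι → ℤ) → K) : (ι → ℤ) → K :=
  fun k => ∑ᶠ j : ℕ, (-1) ^ j * ((pDelta P s)^[j] F) k

/-- The integer powers of the `P`-shift operator. -/
def pShiftPow (P : K) (s : ι) : ℤ → ((ι → ℤ) → K) → (ι → ℤ) → K
  | Int.ofNat i => (pShift P s)^[i]
  | Int.negSucc i => (pShiftInv P s)^[i + 1]

/-- The `PQ`-shift operator `Q id + Δ`. -/
def pqShift (P Q : K) (s : ι) (F : (ι → ℤ) → K) : (ι → ℤ) → K :=
  Q • F + pDelta P s F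

/-- The `PQ`-identity: `Q` times the `P`-shift operator, minus the `P`-difference operator. -/
def pqId (P Q : K) (s : ι) (F : (ι → ℤ) → K) : (ι → ℤ) → K :=
  Q • pShift P s F - pDelta P s F

/-- The operator `∑_{(i,j) ∈ S} f(i,j) E_{k_x}^i E_{k_y}^j`, where `E` is the `P`-shift. -/
def laurentOp (P : K) (S : Finset (ℤ × ℤ)) (f : S → K) (x y : ι) (F : (ι → ℤ) → K) :
    (ι → ℤ) → K :=
  ∑ p : S, f p • pShiftPow P x p.1.1 (pShiftPow P y p.1.2 F)

/-- The factor belonging to the pair `s < t` in the operator formula. -/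
def factorOp (P Q : K) (S : Finset (ℤ × ℤ)) (f : S → K) (s t : ι) (F : (ι → ℤ) → K) :
    (ι → ℤ) → K :=
  pqShift P Q t (pqId P Q s F) - pDelta P s (pDelta P t (laurentOp P S f t s F))

/-- The composition of the operators `T s t`, for `(s, t)` in the list `L`, applied to `F`. -/
def opProd (T : ι → ι → ((ι → ℤ) → K) → (ι → ℤ) → K) (L : List (ι × ι)) (F : (ι → ℤ) → K) :
    (ι → ℤ) → K :=
  L.foldr (fun p G => T p.1 p.2 G) F

end Operators

/-- The first term of the summation operator: with `a = k_n` and `b = k*_{n-1}` as the two variables,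
`Q⁻¹` times the `PQ`-shift in `a` and the `PQ`-identity in `b` applied to
`∑_{l=b}^{a-1} P^l G(l)`. -/
def mainTerm (P Q : K) (G : ℤ → K) (a b : ℤ) : K :=
  Q⁻¹ * pqShift P Q (0 : Fin 2) (pqId P Q (1 : Fin 2)
    fun z => signedSum (z 1) (z 0 - 1) fun l => P ^ l * G l) ![a, b]

/-- The summation operator associated to `(S, f)`; `sumOp P Q S f n A k` is the sum with lower index
`(l_1, …, l_n)` and upper index `k = (k_1, …, k_{n+1})`. For `n = 1` the second term of the
recursion is the summation operator for an empty upper index, which is zero by convention. -/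
def sumOp (P Q : K) (S : Finset (ℤ × ℤ)) (f : S → K) :
    (n : ℕ) → ((Fin n → ℤ) → K) → (Fin (n + 1) → ℤ) → K
  | 0, A, _ => A ![]
  | 1, A, k => mainTerm P Q
      (fun x => sumOp P Q S f 0 (fun l => A (Fin.snoc (α := fun _ => ℤ) l x)) (Fin.init k))
      (k 1) (k 0)
  | n + 2, A, k =>
      mainTerm P Q
        (fun x => sumOp P Q S f (n + 1) (fun l => A (Fin.snoc (α := fun _ => ℤ) l x)) (Fin.init k))
        (k (Fin.last (n + 2))) (k (Fin.last (n + 1)).castSucc)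
      + sumOp P Q S f n
        (fun l => laurentOp P S f (0 : Fin 2) (1 : Fin 2)
          (fun z => A (Fin.snoc (α := fun _ => ℤ) (Fin.snoc (α := fun _ => ℤ) l (z 0)) (z 1)))
          ![k (Fin.last (n + 1)).castSucc, k (Fin.last (n + 1)).castSucc])
        (Fin.init (Fin.init k))

/-- The function `α_{P,Q}(n, m, S, f; k_1, …, k_n)`, for `n ≥ 1` (the value at `n = 0` is a
placeholder). -/
def alpha (P Q : K) (m : ℕ) (S : Finset (ℤ × ℤ)) (f : S → K) : (n : ℕ) → (Fin n → ℤ) → K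
  | 0 => fun _ => 0
  | 1 => fun k => pBinom P (k 0) m
  | n + 2 => sumOp P Q S f (n + 1) (alpha P Q m S f (n + 1))

/-- `det_{1 ≤ i, j ≤ n} [k_i choose j - 1 + δ_{j,n} m]_P`. -/
def binomDet (P : K) (n m : ℕ) (k : Fin n → ℤ) : K :=
  Matrix.det (Matrix.of fun i j : Fin n =>
    pBinom P (k i) ((j : ℕ) + if (j : ℕ) + 1 = n then m else 0))

/-- `∏_{1 ≤ i < j ≤ n} (P^{k_j} - P^{k_i}) / (P^j - P^i)`. -/
def pVandermonde (P : K) (n : ℕ) (k : Fin n → ℤ) : K :=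
  ∏ i : Fin n, ∏ j ∈ Finset.Ioi i,
    (P ^ k j - P ^ k i) / (P ^ ((j : ℕ) + 1) - P ^ ((i : ℕ) + 1))

/-- `∏_{1 ≤ i < j ≤ n} (k_j - k_i) / (j - i)`, the limit of `pVandermonde P n k` as `P → 1`. -/
def vandermonde (K : Type*) [Field K] (n : ℕ) (k : Fin n → ℤ) : K :=
  ∏ i : Fin n, ∏ j ∈ Finset.Ioi i, ((k j : K) - (k i : K)) / ((j : K) - (i : K))

/-- `a = (a_{i,j})_{1 ≤ i ≤ j ≤ n}` is a monotone triangle with bottom row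
`(a_{1,1}, …, a_{1,n}) = k`. (Indices start at `0` here.) -/
structure IsMonotoneTriangle {n : ℕ} (k : Fin n → ℤ)
    (a : {p : Fin n × Fin n // p.1 ≤ p.2} → ℤ) : Prop where
  northeast : ∀ p q, (q.1.1 : ℕ) = p.1.1 + 1 → (q.1.2 : ℕ) = p.1.2 + 1 → a p ≤ a q
  southeast : ∀ p q, (p.1.1 : ℕ) = q.1.1 + 1 → q.1.2 = p.1.2 → a p ≤ a q
  strict : ∀ p q, q.1.1 = p.1.1 → (q.1.2 : ℕ) = p.1.2 + 1 → a p < a q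
  bottom : ∀ p, (p.1.1 : ℕ) = 0 → a p = k p.1.2

end OperatorFormula

end

/-! The `P`-differences in different variables commute, so polynomials in variables `X s` act on
functions by letting `X s` be the `P`-difference in `k_s` (`act`). On functions killed by `X s ^ R`
even the inverse `P`-shift is a polynomial, namely a truncated geometric series. All operators of
the theorem thus become commuting polynomials, and `V_{s,t}` becomes `factorPoly s t`.

The core is `sumOp_eq`. Suppose `A` is the product of all differences applied to some `H`, and
`V_{j,i} H` (indices reversed) vanishes on `x i = x j` for adjacent `i`, `j = i + 1`. Then the
summation operator sends `A` to an alternating sum over `r` of `splitFactor r` applied to `H` at `k`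
without its `r`-th entry. The first term of the recursion telescopes; what remains on the diagonal,
minus the second term, is `V_{j,i} H` at coinciding arguments, hence zero.

For `H` take the product of all `V_{s,t}`, `s < t`, applied to a determinant of `P`-binomials.
Multiplying this product by `V_{j,i}` makes it symmetric in the adjacent variables `i`, `j`, while
the determinant is antisymmetric, so the result vanishes on the diagonal (`act_pairProd_vanish`).
Lowering all lower indices by one shows that `H` is an antidifference of the previous `alpha` up to
a scalar (`act_prod_X_detBinom`).

The next determinant, expanded along its column of ones, has terms free of `k_r`; there `X r` acts
as zero, and putting `X r = 0` turns the larger product of factors into a power of `Q` times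
`splitFactor r` times the smaller product (`dropVar_pairProd`). This matches the alternating sum and
gives `alpha_eq_act` by induction.

Vandermonde evaluation of the determinant yields the product formulas. For monotone triangles,
`sumOp_one_eq_sum` identifies the summation operator with the sum over strictly increasing
interlacing rows. -/

noncomputable section

namespace OperatorFormula

variable {K : Type*} [Field K]

/-! ### Polynomials in the `P`-differences acting on functions -/

section Action

open MvPolynomial

variable {ι κ : Type*} [DecidableEq ι] [DecidableEq κ]

/-- The `P`-difference operator as a linear map. -/
def pDeltaLin (P : K) (s : ι) : Module.End K ((ι → ℤ) → K) where
  toFun := pDelta P s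
  map_add' F G := by ext k; simp only [pDelta, shift, Pi.add_apply]; ring
  map_smul' c F := by
    ext k; simp only [pDelta, shift, Pi.smul_apply, smul_eq_mul, RingHom.id_apply]; ring

theorem pDelta_comm (P : K) (s t : ι) (F : (ι → ℤ) → K) :
    pDelta P s (pDelta P t F) = pDelta P t (pDelta P s F) := by
  rcases eq_or_ne s t with rfl | h
  · rfl
  · ext k
    simp only [pDelta, shift, Function.update_of_ne h, Function.update_of_ne h.symm,
      Function.update_comm h]
    ring

theorem pDeltaLin_mul_comm (P : K) :
    ∀ a ∈ Set.range (pDeltaLin (ι := ι) P), ∀ b ∈ Set.range (pDeltaLin (ι := ι) P),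
      a * b = b * a := by
  rintro _ ⟨s, rfl⟩ _ ⟨t, rfl⟩
  exact LinearMap.ext fun F => pDelta_comm P s t F

/-- The action of polynomials on functions of integer variables in which the variable `X s` acts as
the `P`-difference operator in the variable `s`. -/
def act (P : K) : MvPolynomial ι K →ₐ[K] Module.End K ((ι → ℤ) → K) :=
  -- `aeval` needs a commutative target. The endomorphism ring is not commutative, but the
  -- subalgebra generated by the commuting differences is.
  haveI := Algebra.isMulCommutative_adjoin K (pDeltaLin_mul_comm (ι := ι) P)
  letI : CommRing (Algebra.adjoin K (Set.range (pDeltaLin (ι := ι) P))) :=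
    { (inferInstance : Ring (Algebra.adjoin K (Set.range (pDeltaLin (ι := ι) P)))) with
      mul_comm := mul_comm' }
  (Algebra.adjoin K (Set.range (pDeltaLin (ι := ι) P))).val.comp
    (aeval fun s => ⟨pDeltaLin P s, Algebra.subset_adjoin ⟨s, rfl⟩⟩)

theorem act_X (P : K) (s : ι) (F : (ι → ℤ) → K) : act P (X s) F = pDelta P s F := by
  unfold act
  simp only [AlgHom.comp_apply, aeval_X]
  rfl

theorem act_C (P : K) (c : K) (F : (ι → ℤ) → K) : act P (C c) F = c • F := by
  rw [← algebraMap_eq, AlgHom.commutes]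
  rfl

theorem act_mul (P : K) (p q : MvPolynomial ι K) (F : (ι → ℤ) → K) :
    act P (p * q) F = act P p (act P q F) := by
  rw [map_mul]; rfl

theorem act_add (P : K) (p q : MvPolynomial ι K) (F : (ι → ℤ) → K) :
    act P (p + q) F = act P p F + act P q F := by
  rw [map_add]; rfl

theorem act_sub (P : K) (p q : MvPolynomial ι K) (F : (ι → ℤ) → K) :
    act P (p - q) F = act P p F - act P q F := by
  rw [map_sub]; rfl

theorem act_one (P : K) (F : (ι → ℤ) → K) : act P 1 F = F := by
  rw [map_one]; rfl

theorem act_comm (P : K) (p q : MvPolynomial ι K) (F : (ι → ℤ) → K) :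
    act P p (act P q F) = act P q (act P p F) := by
  rw [← act_mul, mul_comm, act_mul]

theorem act_X_pow (P : K) (s : ι) (r : ℕ) (F : (ι → ℤ) → K) :
    act P (X s ^ r) F = (pDelta P s)^[r] F := by
  induction r generalizing F with
  | zero => simp
  | succ r ih => rw [pow_succ, act_mul, ih, act_X, Function.iterate_succ_apply]

theorem act_sum {α : Type*} (P : K) (T : Finset α) (p : α → MvPolynomial ι K)
    (F : (ι → ℤ) → K) : act P (∑ a ∈ T, p a) F = ∑ a ∈ T, act P (p a) F := by
  rw [map_sum, LinearMap.sum_apply]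

/-- The action is compatible with a substitution of variables as soon as this is so for the
difference operators. -/
theorem act_comp (P : K) (φ : (ι → ℤ) → (κ → ℤ))
    (θ : MvPolynomial ι K →ₐ[K] MvPolynomial κ K)
    (h : ∀ i (F : (κ → ℤ) → K), pDelta P i (F ∘ φ) = act P (θ (X i)) F ∘ φ)
    (p : MvPolynomial ι K) (F : (κ → ℤ) → K) : act P p (F ∘ φ) = act P (θ p) F ∘ φ := by
  induction p using MvPolynomial.induction_on generalizing F with
  | C c =>
    rw [← algebraMap_eq, AlgHom.commutes, AlgHom.commutes, algebraMap_eq, act_C]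
    rfl
  | add p q hp hq => rw [act_add, map_add, act_add, hp, hq]; rfl
  | mul_X p i hp => rw [act_mul, act_X, h, hp, map_mul, act_mul]

theorem act_comp_rename (P : K) (φ : (ι → ℤ) → (κ → ℤ)) (σ : ι → κ)
    (h₁ : ∀ z i, φ z (σ i) = z i)
    (h₂ : ∀ z i v, φ (Function.update z i v) = Function.update (φ z) (σ i) v)
    (p : MvPolynomial ι K) (F : (κ → ℤ) → K) :
    act P p (F ∘ φ) = act P (rename σ p) F ∘ φ := by
  refine act_comp P φ (rename σ) (fun i F => ?_) p F
  ext z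
  simp only [rename_X, act_X, pDelta, shift, Function.comp_apply, h₁, h₂]

end Action

open MvPolynomial in
/-- Operators in variables other than `i`, `j` preserve vanishing for `x i = x j`. -/
theorem act_rename_vanish {ι κ : Type*} [DecidableEq κ] (P : K) (σ : ι → κ) (i j : κ)
    (hi : ∀ a, σ a ≠ i) (hj : ∀ a, σ a ≠ j)
    (p : MvPolynomial ι K) (F : (κ → ℤ) → K) (hF : ∀ x, x i = x j → F x = 0) :
    ∀ x, x i = x j → act P (rename σ p) F x = 0 := by
  induction p using MvPolynomial.induction_on generalizing F with
  | C c =>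
    intro x hx
    rw [rename_C, act_C, Pi.smul_apply, hF x hx, smul_zero]
  | add p q hp hq =>
    intro x hx
    rw [map_add, act_add, Pi.add_apply, hp F hF x hx, hq F hF x hx, add_zero]
  | mul_X p a hp =>
    rw [map_mul, rename_X]
    intro x hx
    rw [act_mul, act_X]
    -- Shifting the variable `σ a` changes neither `y i` nor `y j`, so both points of the difference
    -- lie on the diagonal.
    refine hp _ (fun y hy => ?_) x hx
    rw [pDelta, shift, hF y hy, hF _ (by simp [Function.update_of_ne (hi a).symm,
      Function.update_of_ne (hj a).symm, hy])]
    simp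

/-! ### The operators of the theorem as polynomials -/

section Polynomials

open MvPolynomial

variable {ι κ : Type*}

/-- The polynomial in the `P`-difference operator representing the `i`-th power of the `P`-shift on
functions annihilated by the `R`-th power of the `P`-difference. -/
def shiftPoly (K : Type*) [Field K] (R : ℕ) : ℤ → Polynomial K
  | Int.ofNat i => (Polynomial.X + 1) ^ i
  | Int.negSucc i => (∑ j ∈ Finset.range R, (-1) ^ j * Polynomial.X ^ j) ^ (i + 1)

/-- The polynomial representing `laurentOp P S f x y`. -/
def laurentPoly (R : ℕ) (S : Finset (ℤ × ℤ)) (f : S → K) (x y : ι) : MvPolynomial ι K :=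
  ∑ p : S, C (f p) * (Polynomial.aeval (X x) (shiftPoly K R p.1.1) *
    Polynomial.aeval (X y) (shiftPoly K R p.1.2))

/-- The polynomial representing `pqShift P Q t`. -/
def shiftFactor (Q : K) (t : ι) : MvPolynomial ι K := C Q + X t

/-- The polynomial representing `pqId P Q s`. -/
def idFactor (Q : K) (s : ι) : MvPolynomial ι K := C Q + C (Q - 1) * X s

/-- The polynomial representing `factorOp P Q S f s t`. -/
def factorPoly (R : ℕ) (Q : K) (S : Finset (ℤ × ℤ)) (f : S → K) (s t : ι) : MvPolynomial ι K :=
  shiftFactor Q t * idFactor Q s - X s * X t * laurentPoly R S f t s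

theorem rename_laurentPoly (R : ℕ) (S : Finset (ℤ × ℤ)) (f : S → K) (σ : ι → κ) (x y : ι) :
    rename σ (laurentPoly R S f x y) = laurentPoly R S f (σ x) (σ y) := by
  simp only [laurentPoly, map_sum, map_mul, rename_C, ← Polynomial.aeval_algHom_apply, rename_X]

theorem rename_shiftFactor (Q : K) (σ : ι → κ) (t : ι) :
    rename σ (shiftFactor Q t) = shiftFactor Q (σ t) := by
  simp [shiftFactor]

theorem rename_idFactor (Q : K) (σ : ι → κ) (t : ι) :
    rename σ (idFactor Q t) = idFactor Q (σ t) := by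
  simp [idFactor]

theorem rename_factorPoly (R : ℕ) (Q : K) (S : Finset (ℤ × ℤ)) (f : S → K) (σ : ι → κ) (s t : ι) :
    rename σ (factorPoly R Q S f s t) = factorPoly R Q S f (σ s) (σ t) := by
  simp only [factorPoly, map_sub, map_mul, rename_shiftFactor, rename_idFactor, rename_X,
    rename_laurentPoly]

variable [DecidableEq ι]

theorem pShift_eq_act (P : K) (s : ι) (F : (ι → ℤ) → K) : pShift P s F = act P (X s + 1) F := by
  rw [act_add, act_X, act_one, pShift]

theorem pqShift_eq_act (P Q : K) (s : ι) (F : (ι → ℤ) → K) :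
    pqShift P Q s F = act P (shiftFactor Q s) F := by
  rw [shiftFactor, act_add, act_X, act_C, pqShift]

theorem pqId_eq_act (P Q : K) (s : ι) (F : (ι → ℤ) → K) :
    pqId P Q s F = act P (idFactor Q s) F := by
  rw [idFactor, act_add, act_mul, act_X, act_C, act_C, pqId, pShift, smul_add, sub_smul, one_smul]
  abel

theorem pShiftInv_eq_act (P : K) (s : ι) (R : ℕ) (F : (ι → ℤ) → K) (hF : act P (X s ^ R) F = 0) :
    pShiftInv P s F = act P (∑ j ∈ Finset.range R, (-1) ^ j * X s ^ j) F := by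
  ext k
  have h0 : ∀ j, R ≤ j → (pDelta P s)^[j] F = 0 := by
    intro j hj
    rw [← act_X_pow, ← Nat.sub_add_cancel hj, pow_add, act_mul, hF, map_zero]
  rw [pShiftInv, finsum_eq_sum_of_support_subset (s := Finset.range R), act_sum, Finset.sum_apply]
  · refine Finset.sum_congr rfl fun j _ => ?_
    have : ((-1 : MvPolynomial ι K)) ^ j = C ((-1) ^ j) := by simp
    rw [this, act_mul, act_C, act_X_pow, Pi.smul_apply, smul_eq_mul]
  · intro j hj
    by_contra h
    apply hj
    simp [h0 j (by simpa using h)]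

theorem pShiftPow_eq_act (P : K) (s : ι) (R : ℕ) (i : ℤ) (F : (ι → ℤ) → K)
    (hF : act P (X s ^ R) F = 0) :
    pShiftPow P s i F = act P (Polynomial.aeval (X s) (shiftPoly K R i)) F := by
  rcases i with i | i
  · simp only [pShiftPow, shiftPoly, map_pow, map_add, map_one, Polynomial.aeval_X]
    induction i with
    | zero => simp
    | succ i ih =>
      rw [Function.iterate_succ_apply', ih, pShift_eq_act, pow_succ', map_add, map_one]; rfl
  · simp only [pShiftPow, shiftPoly, map_pow, map_sum, map_mul, map_neg, map_one,
      Polynomial.aeval_X]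
    generalize i + 1 = i
    have key : (pShiftInv P s)^[i] F
        = act P ((∑ j ∈ Finset.range R, (-1) ^ j * X s ^ j) ^ i) F := by
      induction i with
      | zero => simp
      | succ i ih =>
        rw [Function.iterate_succ_apply', ih, pShiftInv_eq_act P s R, pow_succ', act_mul]
        rw [act_comm, hF, map_zero]
    rw [key]
    simp only [map_pow, map_sum, map_mul, map_neg, map_one]

theorem laurentOp_eq_act (P : K) (R : ℕ) (S : Finset (ℤ × ℤ)) (f : S → K) (x y : ι)
    (F : (ι → ℤ) → K) (hx : act P (X x ^ R) F = 0) (hy : act P (X y ^ R) F = 0) :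
    laurentOp P S f x y F = act P (laurentPoly R S f x y) F := by
  rw [laurentOp, laurentPoly, act_sum]
  refine Finset.sum_congr rfl fun p _ => ?_
  rw [act_mul, act_C, act_mul, pShiftPow_eq_act P y R _ F hy, pShiftPow_eq_act P x R]
  rw [act_comm, hx, map_zero]

theorem factorOp_eq_act (P Q : K) (R : ℕ) (S : Finset (ℤ × ℤ)) (f : S → K) (s t : ι)
    (F : (ι → ℤ) → K) (hF : ∀ s, act P (X s ^ R) F = 0) :
    factorOp P Q S f s t F = act P (factorPoly R Q S f s t) F := by
  rw [factorOp, factorPoly, act_sub, act_mul, act_mul, act_mul, pqShift_eq_act, pqId_eq_act,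
    laurentOp_eq_act P R S f t s F (hF t) (hF s), act_X, act_X]

/-- Polynomial operators commute with `X s ^ R`, so every partial composition is still annihilated
by it, and the truncation of the inverse shifts at `R` stays valid factor after factor. -/
theorem opProd_factorOp_eq_act (P Q : K) (R : ℕ) (S : Finset (ℤ × ℤ)) (f : S → K)
    (L : List (ι × ι)) (F : (ι → ℤ) → K) (hF : ∀ s, act P (X s ^ R) F = 0) :
    opProd (factorOp P Q S f) L F
      = act P (L.map fun p => factorPoly R Q S f p.1 p.2).prod F := by
  induction L with
  | nil => simp [opProd]
  | cons p L ih =>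
    have : opProd (factorOp P Q S f) (p :: L) F
        = factorOp P Q S f p.1 p.2 (opProd (factorOp P Q S f) L F) := rfl
    rw [this, ih, List.map_cons, List.prod_cons, act_mul, factorOp_eq_act P Q R]
    intro s
    rw [act_comm, hF, map_zero]

end Polynomials

/-! ### Reduction of the summation operator to evaluations -/

section SummationOperator

open MvPolynomial

theorem signedSum_eq_add (a b : ℤ) (g : ℤ → K) :
    signedSum a b g = signedSum a (b - 1) g + g b := by
  unfold signedSum
  rcases lt_trichotomy a b with h | rfl | h
  · have e : Finset.Icc a b = insert b (Finset.Icc a (b - 1)) := by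
      ext y; simp only [Finset.mem_Icc, Finset.mem_insert]; omega
    rw [if_pos h.le, if_pos (by omega), e, Finset.sum_insert (by simp), add_comm]
  · simp
  · have e : Finset.Icc b (a - 1) = insert b (Finset.Icc (b + 1) (a - 1)) := by
      ext y; simp only [Finset.mem_Icc, Finset.mem_insert]; omega
    rw [if_neg (by omega), if_neg (by omega), sub_add_cancel, e, Finset.sum_insert (by simp)]
    ring

theorem signedSum_eq_sub (g G : ℤ → K) (h : ∀ x, G (x + 1) = G x + g x) (a x : ℤ) :
    signedSum a (x - 1) g = G x - G a := by
  induction x using Int.inductionOn' (b := a) with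
  | zero => simp [signedSum]
  | succ x _ ih => rw [signedSum_eq_add, add_sub_cancel_right, ih, h]; ring
  | pred x _ ih =>
    rw [signedSum_eq_add] at ih
    have := h (x - 1)
    rw [sub_add_cancel] at this
    linear_combination ih + this

/-- The sum telescopes to `H a - H b`. Each of the two operators multiplies the part free of its
variable by `Q`, and this `Q` cancels `Q⁻¹`. -/
theorem mainTerm_eq (P Q : K) (hP : P ≠ 0) (hQ : Q ≠ 0) (G H : ℤ → K)
    (h : ∀ x, H (x + 1) = H x + P ^ x * G x) (a b : ℤ) :
    mainTerm P Q G a b = (Q * H a + G a) - (Q * H b + (Q - 1) * G b) := by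
  have e : (fun z : Fin 2 → ℤ => signedSum (z 1) (z 0 - 1) fun l => P ^ l * G l)
      = fun z => H (z 0) - H (z 1) := by
    ext z
    exact signedSum_eq_sub _ _ h _ _
  have ha : P ^ a ≠ 0 := zpow_ne_zero _ hP
  have hb : P ^ b ≠ 0 := zpow_ne_zero _ hP
  rw [mainTerm, e]
  simp only [pqShift, pqId, pShift, pDelta, shift, Pi.add_apply, Pi.sub_apply, Pi.smul_apply,
    smul_eq_mul]
  simp [h, zpow_neg]
  field_simp
  ring

theorem act_snoc {n : ℕ} (P : K) (x : ℤ) (p : MvPolynomial (Fin n) K)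
    (F : (Fin (n + 1) → ℤ) → K) (l : Fin n → ℤ) :
    act P p (fun l => F (Fin.snoc (α := fun _ => ℤ) l x)) l
      = act P (rename Fin.castSucc p) F (Fin.snoc (α := fun _ => ℤ) l x) := by
  have := act_comp_rename P (fun l : Fin n → ℤ => Fin.snoc (α := fun _ => ℤ) l x) Fin.castSucc
    (fun z i => by simp) (fun z i v => by simp [Fin.snoc_update]) p F
  exact congrFun this l

theorem act_snoc_snoc {n : ℕ} (P : K) (l : Fin n → ℤ) (p : MvPolynomial (Fin 2) K)
    (F : (Fin (n + 2) → ℤ) → K) (z : Fin 2 → ℤ) :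
    act P p (fun z => F (Fin.snoc (α := fun _ => ℤ) (Fin.snoc (α := fun _ => ℤ) l (z 0)) (z 1))) z
      = act P (rename ![(Fin.last n).castSucc, Fin.last (n + 1)] p) F
        (Fin.snoc (α := fun _ => ℤ) (Fin.snoc (α := fun _ => ℤ) l (z 0)) (z 1)) := by
  have := act_comp_rename P
    (fun z : Fin 2 → ℤ =>
      (Fin.snoc (α := fun _ => ℤ) (Fin.snoc (α := fun _ => ℤ) l (z 0)) (z 1) : Fin (n + 2) → ℤ))
    ![(Fin.last n).castSucc, Fin.last (n + 1)]
    (fun z i => by fin_cases i <;> simp)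
    (fun z i v => by
      fin_cases i
      · simp [← Fin.snoc_update, Fin.update_snoc_last]
      · simp [Fin.update_snoc_last]) p F
  exact congrFun this z

theorem pDelta_snoc {n : ℕ} (P : K) (hP : P ≠ 0) (F : (Fin (n + 1) → ℤ) → K) (l : Fin n → ℤ)
    (x : ℤ) :
    F (Fin.snoc (α := fun _ => ℤ) l (x + 1)) = F (Fin.snoc (α := fun _ => ℤ) l x)
      + P ^ x * pDelta P (Fin.last n) F (Fin.snoc (α := fun _ => ℤ) l x) := by
  have : P ^ x ≠ 0 := zpow_ne_zero _ hP
  simp only [pDelta, shift, Fin.update_snoc_last, Fin.snoc_last, zpow_neg]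
  field_simp
  ring

/-- The product of the operators `idFactor` in the variables before position `r`, and of the
operators `shiftFactor` in those after it. -/
def splitFactor (Q : K) {n : ℕ} (r : Fin (n + 1)) : MvPolynomial (Fin n) K :=
  ∏ i : Fin n, if i.castSucc < r then idFactor Q i else shiftFactor Q i

theorem splitFactor_castSucc (Q : K) {n : ℕ} (r : Fin (n + 1)) :
    splitFactor Q r.castSucc
      = rename Fin.castSucc (splitFactor Q r) * shiftFactor Q (Fin.last n) := by
  rw [splitFactor, Fin.prod_univ_castSucc, if_neg (by simp [Fin.le_last]), splitFactor, map_prod]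
  congr 1
  refine Finset.prod_congr rfl fun i _ => ?_
  simp only [Fin.castSucc_lt_castSucc_iff]
  split_ifs
  · rw [rename_idFactor]
  · rw [rename_shiftFactor]

theorem splitFactor_last (Q : K) {n : ℕ} :
    splitFactor Q (Fin.last (n + 1))
      = rename Fin.castSucc (splitFactor Q (Fin.last n)) * idFactor Q (Fin.last n) := by
  rw [splitFactor, Fin.prod_univ_castSucc, if_pos (Fin.castSucc_lt_last _), splitFactor, map_prod]
  congr 1
  refine Finset.prod_congr rfl fun i _ => ?_
  rw [if_pos (Fin.castSucc_lt_last _), if_pos (Fin.castSucc_lt_last _), rename_idFactor]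

theorem snoc_init_comp_succAbove {n : ℕ} (k : Fin (n + 2) → ℤ) (r : Fin (n + 1)) :
    (Fin.snoc (α := fun _ => ℤ) (Fin.init k ∘ r.succAbove) (k (Fin.last (n + 1)))
      : Fin (n + 1) → ℤ) = k ∘ r.castSucc.succAbove := by
  ext i
  refine Fin.lastCases ?_ (fun i => ?_) i
  · simp [Fin.succAbove_of_le_castSucc, Fin.le_last]
  · simp [Fin.init, Fin.castSucc_succAbove_castSucc]

/-- Used for the boundary term: removing the last entry of `Fin.init k` and appending it again as
the lower summation limit amounts to removing the last entry of `k`. -/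
theorem snoc_init_last {n : ℕ} (k : Fin (n + 2) → ℤ) :
    (Fin.snoc (α := fun _ => ℤ) (Fin.init k ∘ (Fin.last n).succAbove) (k (Fin.last n).castSucc)
      : Fin (n + 1) → ℤ) = k ∘ (Fin.last (n + 1)).succAbove := by
  ext i
  refine Fin.lastCases ?_ (fun i => ?_) i
  · simp
  · simp [Fin.init]

/-- The difference between the two sides of the reduction formula for the summation operator that
the first term of the recursion leaves over. -/
theorem mainTerm_sumOp (P Q : K) (hP : P ≠ 0) (hQ : Q ≠ 0) (S : Finset (ℤ × ℤ)) (f : S → K)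
    {n : ℕ} (H : (Fin (n + 1) → ℤ) → K) (k : Fin (n + 2) → ℤ)
    (ih : ∀ x, sumOp P Q S f n (act P (∏ s, X s)
        (fun l => act P (X (Fin.last n)) H (Fin.snoc (α := fun _ => ℤ) l x))) (Fin.init k)
      = ∑ r : Fin (n + 1), (-1) ^ (r : ℕ) * act P (splitFactor Q r)
        (fun l => act P (X (Fin.last n)) H (Fin.snoc (α := fun _ => ℤ) l x))
          (Fin.init k ∘ r.succAbove)) :
    mainTerm P Q (fun x => sumOp P Q S f n
        (fun l => act P (∏ s, X s) H (Fin.snoc (α := fun _ => ℤ) l x)) (Fin.init k))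
        (k (Fin.last (n + 1))) (k (Fin.last n).castSucc)
      = (∑ r : Fin (n + 2), (-1) ^ (r : ℕ) * act P (splitFactor Q r) H (k ∘ r.succAbove))
        - ∑ r : Fin n, (-1) ^ (r : ℕ) * act P (rename Fin.castSucc (splitFactor Q r.castSucc)
          * idFactor Q (Fin.last n)) H (Fin.snoc (α := fun _ => ℤ)
            (Fin.init k ∘ r.castSucc.succAbove) (k (Fin.last n).castSucc)) := by
  have e1 : ∀ x, (fun l => act P (∏ s, X s) H (Fin.snoc (α := fun _ => ℤ) l x))
      = act P (∏ s, X s) (fun l => act P (X (Fin.last n)) H (Fin.snoc (α := fun _ => ℤ) l x)) := by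
    intro x
    ext l
    rw [act_snoc, ← act_mul, Fin.prod_univ_castSucc, map_prod]
    simp only [rename_X]
  simp only [e1, ih, act_snoc, ← act_mul]
  -- The antidifference in the last variable is found by omitting the factor `X (Fin.last n)`.
  rw [mainTerm_eq P Q hP hQ _ (fun x => ∑ r : Fin (n + 1), (-1) ^ (r : ℕ) *
    act P (rename Fin.castSucc (splitFactor Q r)) H
      (Fin.snoc (α := fun _ => ℤ) (Fin.init k ∘ r.succAbove) x))]
  · have s1 : ∀ a, Q * (∑ r : Fin (n + 1), (-1) ^ (r : ℕ) *
          act P (rename Fin.castSucc (splitFactor Q r)) H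
          (Fin.snoc (α := fun _ => ℤ) (Fin.init k ∘ r.succAbove) a))
        + (∑ r : Fin (n + 1), (-1) ^ (r : ℕ) *
          act P (rename Fin.castSucc (splitFactor Q r) * X (Fin.last n)) H
          (Fin.snoc (α := fun _ => ℤ) (Fin.init k ∘ r.succAbove) a))
        = ∑ r : Fin (n + 1), (-1) ^ (r : ℕ) *
          act P (rename Fin.castSucc (splitFactor Q r) * shiftFactor Q (Fin.last n)) H
          (Fin.snoc (α := fun _ => ℤ) (Fin.init k ∘ r.succAbove) a) := by
      intro a
      rw [Finset.mul_sum, ← Finset.sum_add_distrib]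
      refine Finset.sum_congr rfl fun r _ => ?_
      rw [shiftFactor, mul_add, mul_comm _ (C Q), act_add, act_mul P (C Q), act_C, Pi.add_apply,
        Pi.smul_apply, smul_eq_mul]
      ring
    have s2 : ∀ a, Q * (∑ r : Fin (n + 1), (-1) ^ (r : ℕ) *
          act P (rename Fin.castSucc (splitFactor Q r)) H
          (Fin.snoc (α := fun _ => ℤ) (Fin.init k ∘ r.succAbove) a))
        + (Q - 1) * (∑ r : Fin (n + 1), (-1) ^ (r : ℕ) *
          act P (rename Fin.castSucc (splitFactor Q r) * X (Fin.last n)) H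
          (Fin.snoc (α := fun _ => ℤ) (Fin.init k ∘ r.succAbove) a))
        = ∑ r : Fin (n + 1), (-1) ^ (r : ℕ) *
          act P (rename Fin.castSucc (splitFactor Q r) * idFactor Q (Fin.last n)) H
          (Fin.snoc (α := fun _ => ℤ) (Fin.init k ∘ r.succAbove) a) := by
      intro a
      rw [Finset.mul_sum, Finset.mul_sum, ← Finset.sum_add_distrib]
      refine Finset.sum_congr rfl fun r _ => ?_
      rw [idFactor, mul_add, mul_comm _ (C Q), mul_left_comm _ (C (Q - 1)), act_add,
        act_mul P (C Q), act_C,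
        act_mul P (C (Q - 1)), act_C, Pi.add_apply, Pi.smul_apply, smul_eq_mul, Pi.smul_apply,
        smul_eq_mul]
      ring
    rw [s1, s2, Fin.sum_univ_castSucc (n := n + 1)]
    simp only [← splitFactor_castSucc, snoc_init_comp_succAbove]
    -- The upper limit has supplied all terms but the one omitting the last entry. That one is the
    -- `r = n` term of the lower limit, with its sign reversed; the terms `r < n` are the leftover.
    rw [Fin.sum_univ_castSucc (n := n)
      (f := fun r : Fin (n + 1) => (-1) ^ (r : ℕ) * act P (rename Fin.castSucc (splitFactor Q r)
          * idFactor Q (Fin.last n)) H (Fin.snoc (α := fun _ => ℤ)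
            (Fin.init k ∘ r.succAbove) (k (Fin.last n).castSucc))),
      ← splitFactor_last, snoc_init_last]
    simp only [Fin.val_castSucc, Fin.val_last]
    ring
  · intro x
    rw [Finset.mul_sum, ← Finset.sum_add_distrib]
    refine Finset.sum_congr rfl fun r _ => ?_
    rw [pDelta_snoc P hP (act P (rename Fin.castSucc (splitFactor Q r)) H), ← act_X, ← act_mul,
      mul_comm (X _)]
    ring

theorem act_snoc_snoc_left {n : ℕ} (P : K) (a b : ℤ) (p : MvPolynomial (Fin n) K)
    (F : (Fin (n + 2) → ℤ) → K) (l : Fin n → ℤ) :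
    act P p (fun l => F (Fin.snoc (α := fun _ => ℤ) (Fin.snoc (α := fun _ => ℤ) l a) b)) l
      = act P (rename Fin.castSucc (rename Fin.castSucc p)) F
        (Fin.snoc (α := fun _ => ℤ) (Fin.snoc (α := fun _ => ℤ) l a) b) := by
  rw [← act_snoc, ← act_snoc]

/-- The operator in the second term of the recursion, in terms of an antidifference. -/
theorem laurentOp_act_prod (P : K) (S : Finset (ℤ × ℤ)) (f : S → K) (R : ℕ) {n : ℕ}
    (H : (Fin (n + 2) → ℤ) → K) (hN : ∀ s, act P (X s ^ R) H = 0) (b : ℤ) :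
    (fun l : Fin n → ℤ => laurentOp P S f (0 : Fin 2) (1 : Fin 2)
          (fun z => act P (∏ s, X s) H
            (Fin.snoc (α := fun _ => ℤ) (Fin.snoc (α := fun _ => ℤ) l (z 0)) (z 1))) ![b, b])
        = act P (∏ s, X s) (fun l : Fin n → ℤ =>
          act P (rename ![(Fin.last n).castSucc, Fin.last (n + 1)]
            (X 0 * X 1 * laurentPoly R S f 0 1)) H
          (Fin.snoc (α := fun _ => ℤ) (Fin.snoc (α := fun _ => ℤ) l b) b)) := by
  ext l
  have hz : ∀ i : Fin 2, act P (X i ^ R) (fun z : Fin 2 → ℤ => act P (∏ s, X s) H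
      (Fin.snoc (α := fun _ => ℤ) (Fin.snoc (α := fun _ => ℤ) l (z 0)) (z 1))) = 0 := by
    intro i
    ext z
    rw [act_snoc_snoc, map_pow, rename_X, act_comm, hN, map_zero]
    rfl
  rw [laurentOp_eq_act P R S f 0 1 _ (hz 0) (hz 1), act_snoc_snoc, act_snoc_snoc_left, ← act_mul,
    ← act_mul]
  have e : rename ![(Fin.last n).castSucc, Fin.last (n + 1)] (laurentPoly R S f 0 1) *
        ∏ s : Fin (n + 2), (X s : MvPolynomial (Fin (n + 2)) K)
      = rename Fin.castSucc (rename Fin.castSucc (∏ s : Fin n, X s)) *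
        rename ![(Fin.last n).castSucc, Fin.last (n + 1)]
            (X 0 * X 1 * laurentPoly R S f 0 1) := by
    rw [Fin.prod_univ_castSucc, Fin.prod_univ_castSucc, map_prod, map_prod, map_mul, map_mul]
    simp only [rename_X, Matrix.cons_val_zero, Matrix.cons_val_one]
    ring
  rw [e]
  rfl

/-- The reduction of the summation operator to evaluations, for a function with a suitable
antidifference `H`. -/
theorem sumOp_eq (P Q : K) (hP : P ≠ 0) (hQ : Q ≠ 0) (S : Finset (ℤ × ℤ)) (f : S → K) (R : ℕ) :
    ∀ (n : ℕ) (H : (Fin n → ℤ) → K) (_ : ∀ s, act P (X s ^ R) H = 0)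
      (_ : ∀ i j : Fin n, (j : ℕ) = i + 1 → ∀ x, x i = x j →
        act P (factorPoly R Q S f j i) H x = 0) (k : Fin (n + 1) → ℤ),
      sumOp P Q S f n (act P (∏ s, X s) H) k
        = ∑ r : Fin (n + 1), (-1) ^ (r : ℕ) * act P (splitFactor Q r) H (k ∘ r.succAbove)
  | 0, H, _, _, k => by
    have h0 : ∀ a b : Fin 0 → ℤ, a = b := fun a b => funext fun i => i.elim0
    rw [Fin.sum_univ_one, sumOp, splitFactor, Finset.univ_eq_empty (α := Fin 0), Finset.prod_empty,
      Finset.prod_empty, act_one, h0 ![] (k ∘ Fin.succAbove 0)]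
    simp
  | 1, H, hN, hV, k => by
    have := mainTerm_sumOp P Q hP hQ S f H k (fun x => sumOp_eq P Q hP hQ S f R 0 _
      (fun s => s.elim0) (fun s => s.elim0) _)
    -- With a single summation variable there is no leftover, in agreement with the missing second
    -- term.
    rw [Finset.univ_eq_empty (α := Fin 0), Finset.sum_empty, sub_zero] at this
    rw [← this]
    rfl
  | n + 2, H, hN, hV, k => by
    have hlast : ∀ s : Fin (n + 1), s.castSucc ≠ Fin.last (n + 1) :=
      fun s => (Fin.castSucc_lt_last s).ne
    have main := mainTerm_sumOp P Q hP hQ S f H k (fun x => sumOp_eq P Q hP hQ S f R (n + 1) _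
      (fun s => by
        ext l
        rw [act_snoc, map_pow, rename_X, act_comm, hN, map_zero]; rfl)
      (fun i j hij y hy => by
        rw [act_snoc, rename_factorPoly, act_comm]
        -- The function to which the induction hypothesis is applied carries an extra difference in
        -- the last variable, which differs from `i` and `j` and so preserves the vanishing.
        have := act_rename_vanish P (fun _ : Unit => Fin.last (n + 1)) i.castSucc j.castSucc
          (fun _ => (hlast _).symm) (fun _ => (hlast _).symm) (X ()) _
          (hV i.castSucc j.castSucc (by simpa using hij))
        rw [rename_X] at this
        exact this _ (by simpa using hy)) _)
    have hne : ∀ (i : Fin n) a, (![(Fin.last n).castSucc, Fin.last (n + 1)] : Fin 2 → Fin (n + 2)) a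
        ≠ i.castSucc.castSucc := by
      intro i a
      have := i.2
      fin_cases a <;> simp [Fin.ext_iff] <;> omega
    have second := fun b => sumOp_eq P Q hP hQ S f R n (fun l : Fin n → ℤ =>
          act P (rename ![(Fin.last n).castSucc, Fin.last (n + 1)]
            (X 0 * X 1 * laurentPoly R S f 0 1)) H
          (Fin.snoc (α := fun _ => ℤ) (Fin.snoc (α := fun _ => ℤ) l b) b))
      (fun s => by
        ext l
        rw [act_snoc_snoc_left, map_pow, rename_X, map_pow, rename_X, act_comm, hN, map_zero]; rfl)
      (fun i j hij y hy => by
        rw [act_snoc_snoc_left, rename_factorPoly, rename_factorPoly, act_comm]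
        refine act_rename_vanish P _ i.castSucc.castSucc j.castSucc.castSucc (hne i) (hne j) _ _
          (hV i.castSucc.castSucc j.castSucc.castSucc (by simpa using hij)) _ (by simpa using hy))
    rw [sumOp, main, laurentOp_act_prod P S f R H hN, second, sub_add, sub_eq_self,
      ← Finset.sum_sub_distrib]
    refine Finset.sum_eq_zero fun r _ => ?_
    generalize hb : k (Fin.last (n + 1)).castSucc = b
    have hpt : (Fin.init k ∘ r.castSucc.succAbove : Fin (n + 1) → ℤ)
        = Fin.snoc (α := fun _ => ℤ) (Fin.init (Fin.init k) ∘ r.succAbove) b := by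
      rw [← hb]
      exact (snoc_init_comp_succAbove (Fin.init k) r).symm
    rw [hpt, act_snoc_snoc_left, ← mul_sub, splitFactor_castSucc, ← act_mul,
      ← Pi.sub_apply, ← act_sub]
    -- The decisive cancellation: leftover minus second term contains exactly `factorPoly` for the
    -- last two positions in reversed order, which kills `H` on the diagonal.
    have e : rename Fin.castSucc (rename Fin.castSucc (splitFactor Q r) *
          shiftFactor Q (Fin.last n)) * idFactor Q (Fin.last (n + 1))
        - rename Fin.castSucc (rename Fin.castSucc (splitFactor Q r))
          * rename ![(Fin.last n).castSucc, Fin.last (n + 1)] (X 0 * X 1 * laurentPoly R S f 0 1)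
        = rename Fin.castSucc (rename Fin.castSucc (splitFactor Q r))
          * factorPoly R Q S f (Fin.last (n + 1)) (Fin.last n).castSucc := by
      rw [map_mul, rename_shiftFactor, factorPoly, map_mul, map_mul, rename_laurentPoly, rename_X,
        rename_X]
      simp only [Matrix.cons_val_zero, Matrix.cons_val_one]
      ring
    have z : (fun l : Fin n → ℤ =>
        act P (factorPoly R Q S f (Fin.last (n + 1)) (Fin.last n).castSucc) H
          (Fin.snoc (α := fun _ => ℤ) (Fin.snoc (α := fun _ => ℤ) l b) b)) = 0 := by
      ext l
      exact hV _ _ (by simp) _ (by simp)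
    rw [e, act_mul, ← act_snoc_snoc_left, z, map_zero, Pi.zero_apply, mul_zero]

end SummationOperator

/-! ### Determinants of `P`-binomial coefficients -/

section Determinant

open MvPolynomial

/-- The `P`-difference of a function of one variable. -/
def delta (P : K) (g : ℤ → K) : ℤ → K := fun x => P ^ (-x) * (g (x + 1) - g x)

theorem delta_zero (P : K) : delta P 0 = 0 := by
  ext x; simp [delta]

theorem delta_smul (P c : K) (g : ℤ → K) : delta P (c • g) = c • delta P g := by
  ext x; simp only [delta, Pi.smul_apply, smul_eq_mul]; ring

theorem delta_iterate_smul (P c : K) (g : ℤ → K) (r : ℕ) :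
    (delta P)^[r] (c • g) = c • (delta P)^[r] g := by
  induction r with
  | zero => rfl
  | succ r ih => rw [Function.iterate_succ_apply', Function.iterate_succ_apply', ih, delta_smul]

theorem delta_pBinom_zero (P : K) : delta P (fun x => pBinom P x 0) = 0 := by
  ext x; simp [delta, pBinom]

theorem delta_pBinom_succ (P : K) (hP : P ≠ 0) (m : ℕ) :
    delta P (fun x => pBinom P x (m + 1)) = P ^ (-(m : ℤ)) • fun x => pBinom P x m := by
  ext x
  have h : pBinom P (x + 1) (m + 1) = pBinom P x (m + 1) + P ^ (x - (m : ℤ)) * pBinom P x m := by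
    rw [pBinom, pBinom, add_sub_cancel_right, signedSum_eq_add]
  simp only [delta, h, add_sub_cancel_left, Pi.smul_apply, smul_eq_mul]
  rw [← mul_assoc, ← zpow_add₀ hP]
  congr 2
  ring

theorem delta_iterate_pBinom (P : K) (hP : P ≠ 0) (m r : ℕ) (h : m < r) :
    (delta P)^[r] (fun x => pBinom P x m) = 0 := by
  have h0 : ∀ r, (delta P)^[r] 0 = 0 := fun r => Function.iterate_fixed (delta_zero P) r
  induction m generalizing r with
  | zero =>
    obtain ⟨r, rfl⟩ := Nat.exists_eq_add_of_lt h
    rw [Function.iterate_succ_apply, delta_pBinom_zero, h0]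
  | succ m ih =>
    obtain ⟨r, rfl⟩ : ∃ r', r = r' + 1 := ⟨r - 1, by omega⟩
    rw [Function.iterate_succ_apply, delta_pBinom_succ P hP, delta_iterate_smul, ih r (by omega),
      smul_zero]

variable {ι : Type*} [Fintype ι] [DecidableEq ι]

/-- The product of functions of one variable each. -/
def prodFun (g : ι → ℤ → K) : (ι → ℤ) → K := fun x => ∏ i, g i (x i)

theorem pDelta_prodFun (P : K) (s : ι) (g : ι → ℤ → K) :
    pDelta P s (prodFun g) = prodFun (Function.update g s (delta P (g s))) := by
  ext x
  simp only [pDelta, shift, prodFun]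
  rw [← Finset.mul_prod_erase _ _ (Finset.mem_univ s), ← Finset.mul_prod_erase Finset.univ
    (fun i => g i (x i)) (Finset.mem_univ s), ← Finset.mul_prod_erase Finset.univ
    (fun i => Function.update g s (delta P (g s)) i (x i)) (Finset.mem_univ s)]
  have e1 : ∏ i ∈ Finset.univ.erase s, g i (Function.update x s (x s + 1) i)
      = ∏ i ∈ Finset.univ.erase s, g i (x i) :=
    Finset.prod_congr rfl fun i hi => by rw [Function.update_of_ne (Finset.ne_of_mem_erase hi)]
  have e2 : ∏ i ∈ Finset.univ.erase s, Function.update g s (delta P (g s)) i (x i)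
      = ∏ i ∈ Finset.univ.erase s, g i (x i) :=
    Finset.prod_congr rfl fun i hi => by rw [Function.update_of_ne (Finset.ne_of_mem_erase hi)]
  rw [e1, e2, Function.update_self, Function.update_self, delta]
  ring

theorem act_prod_X_prodFun (P : K) (T : Finset ι) (g : ι → ℤ → K) :
    act P (∏ i ∈ T, X i) (prodFun g) = prodFun fun i => if i ∈ T then delta P (g i) else g i := by
  induction T using Finset.induction_on with
  | empty => simp
  | insert a T ha ih =>
    rw [Finset.prod_insert ha, act_mul, ih, act_X, pDelta_prodFun, if_neg ha]
    congr 1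
    ext i
    rcases eq_or_ne i a with rfl | h
    · simp
    · simp [h]

theorem act_X_pow_prodFun (P : K) (s : ι) (r : ℕ) (g : ι → ℤ → K) :
    act P (X s ^ r) (prodFun g) = prodFun (Function.update g s ((delta P)^[r] (g s))) := by
  induction r with
  | zero => simp
  | succ r ih =>
    rw [pow_succ', act_mul, ih, act_X, pDelta_prodFun, Function.update_self, Function.update_idem,
      Function.iterate_succ_apply']

/-- The determinant of the `P`-binomial coefficients `[x_i choose d_j]`. -/
def detBinom (P : K) (d : ι → ℕ) : (ι → ℤ) → K :=
  fun x => Matrix.det (Matrix.of fun i j => pBinom P (x i) (d j))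

/-- Each summand is a product of one-variable functions, so a difference in `s` affects only one
factor. -/
theorem detBinom_eq_sum (P : K) (d : ι → ℕ) :
    detBinom P d = ∑ σ : Equiv.Perm ι, ((Equiv.Perm.sign σ : ℤ) : K) •
      prodFun fun i x => pBinom P x (d (σ i)) := by
  ext x
  rw [detBinom, ← Matrix.det_transpose, Matrix.det_apply', Finset.sum_apply]
  rfl

theorem act_X_pow_detBinom (P : K) (hP : P ≠ 0) (d : ι → ℕ) (R : ℕ) (hd : ∀ j, d j < R) (s : ι) :
    act P (X s ^ R) (detBinom P d) = 0 := by
  rw [detBinom_eq_sum, map_sum]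
  refine Finset.sum_eq_zero fun σ _ => ?_
  rw [map_smul, act_X_pow_prodFun, delta_iterate_pBinom P hP _ _ (hd _)]
  ext x
  rw [Pi.smul_apply, prodFun, Finset.prod_eq_zero (Finset.mem_univ s) (by simp)]
  simp

/-- Provides the antidifference of the determinant. By the `P`-Pascal rule each difference lowers
one lower index, and every permutation summand collects the same scalar. -/
theorem act_prod_X_detBinom (P : K) (hP : P ≠ 0) (d : ι → ℕ) :
    act P (∏ i, X i) (detBinom P fun j => d j + 1)
      = P ^ (-∑ j, (d j : ℤ)) • detBinom P d := by
  rw [detBinom_eq_sum, detBinom_eq_sum, map_sum, Finset.smul_sum]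
  refine Finset.sum_congr rfl fun σ _ => ?_
  rw [map_smul, act_prod_X_prodFun, smul_comm]
  congr 1
  ext x
  simp only [Finset.mem_univ, if_true, delta_pBinom_succ P hP, prodFun, Pi.smul_apply, smul_eq_mul]
  rw [Finset.prod_mul_distrib]
  congr 1
  rw [Equiv.prod_comp σ (fun i => P ^ (-(d i : ℤ))), ← Finset.sum_neg_distrib]
  induction (Finset.univ : Finset ι) using Finset.induction_on with
  | empty => simp
  | insert a T ha ih => rw [Finset.prod_insert ha, Finset.sum_insert ha, zpow_add₀ hP, ih]

theorem detBinom_swap (P : K) (d : ι → ℕ) (i j : ι) (hij : i ≠ j) (x : ι → ℤ) :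
    detBinom P d (x ∘ Equiv.swap i j) = - detBinom P d x := by
  have := Matrix.det_permute (Equiv.swap i j) (Matrix.of fun i j => pBinom P (x i) (d j))
  rw [Equiv.Perm.sign_swap hij] at this
  exact this.trans (by simp [detBinom])

/-- Laplace expansion along the first column, whose entries are all `1`. -/
theorem detBinom_cons (P : K) {n : ℕ} (d : Fin n → ℕ) (k : Fin (n + 1) → ℤ) :
    detBinom P (Fin.cons (α := fun _ => ℕ) 0 d) k
      = ∑ r : Fin (n + 1), (-1) ^ (r : ℕ) * detBinom P d (k ∘ r.succAbove) := by
  rw [detBinom, Matrix.det_succ_column_zero]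
  refine Finset.sum_congr rfl fun r _ => ?_
  simp only [Matrix.of_apply, Fin.cons_zero, pBinom, mul_one]
  congr 1

end Determinant

/-! ### Symmetry and specialization of the product of the factors -/

section Product

open MvPolynomial

/-- The product of the polynomials of all pairs `s < t`. -/
def pairProd (R : ℕ) (Q : K) (S : Finset (ℤ × ℤ)) (f : S → K) (n : ℕ) : MvPolynomial (Fin n) K :=
  ∏ s : Fin n, ∏ t : Fin n, if s < t then factorPoly R Q S f s t else 1

theorem pairProd_eq (R : ℕ) (Q : K) (S : Finset (ℤ × ℤ)) (f : S → K) (n : ℕ) :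
    pairProd R Q S f n
      = ∏ p : Fin n × Fin n with p.1 < p.2, factorPoly R Q S f p.1 p.2 := by
  rw [Finset.prod_filter, ← Finset.univ_product_univ, Finset.prod_product, pairProd]

theorem list_prod_eq_pairProd (R : ℕ) (Q : K) (S : Finset (ℤ × ℤ)) (f : S → K) (n : ℕ)
    (L : List (Fin n × Fin n)) (hL : L.Nodup) (h : ∀ p, p ∈ L ↔ p.1 < p.2) :
    (L.map fun p => factorPoly R Q S f p.1 p.2).prod = pairProd R Q S f n := by
  rw [pairProd_eq, ← List.prod_toFinset _ hL]
  refine Finset.prod_congr ?_ fun _ _ => rfl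
  ext p
  simp [h]

/-- As `i` and `j` are adjacent, `(i, j)` is the only increasing pair whose order the swap reverses.
Adding `(j, i)` makes the set of pairs invariant. -/
theorem rename_swap_pairProd (R : ℕ) (Q : K) (S : Finset (ℤ × ℤ)) (f : S → K) {n : ℕ}
    (i j : Fin n) (hij : (j : ℕ) = i + 1) :
    rename (Equiv.swap i j) (factorPoly R Q S f j i * pairProd R Q S f n)
      = factorPoly R Q S f j i * pairProd R Q S f n := by
  have e : factorPoly R Q S f j i * pairProd R Q S f n
      = ∏ p ∈ insert (j, i) (Finset.univ.filter fun p : Fin n × Fin n => p.1 < p.2),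
        factorPoly R Q S f p.1 p.2 := by
    rw [Finset.prod_insert, pairProd_eq]
    simp [Fin.le_def, hij]
  rw [e, map_prod]
  simp only [rename_factorPoly]
  refine Finset.prod_equiv ((Equiv.swap i j).prodCongr (Equiv.swap i j)) (fun p => ?_)
    fun p _ => rfl
  obtain ⟨s, t⟩ := p
  simp only [Finset.mem_insert, Finset.mem_filter, Finset.mem_univ, true_and, Prod.mk.injEq,
    Equiv.prodCongr_apply, Prod.map_apply, Equiv.swap_apply_def, Fin.lt_def, Fin.ext_iff]
  split_ifs <;> simp_all <;> omega

/-- A symmetric operator applied to an antisymmetric function is antisymmetric, so twice its value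
on the diagonal is zero. -/
theorem act_pairProd_vanish [CharZero K] (P : K) (R : ℕ) (Q : K) (S : Finset (ℤ × ℤ))
    (f : S → K) {n : ℕ} (d : Fin n → ℕ) (i j : Fin n) (hij : (j : ℕ) = i + 1) (x : Fin n → ℤ)
    (hx : x i = x j) :
    act P (factorPoly R Q S f j i) (act P (pairProd R Q S f n) (detBinom P d)) x = 0 := by
  have hne : i ≠ j := by rintro rfl; omega
  have e := act_comp_rename P (fun x : Fin n → ℤ => x ∘ Equiv.swap i j) (Equiv.swap i j)
    (fun z a => by simp)
    (fun z a v => by rw [Function.update_comp_equiv, Equiv.symm_swap])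
    (factorPoly R Q S f j i * pairProd R Q S f n) (detBinom P d)
  rw [rename_swap_pairProd R Q S f i j hij] at e
  have e2 : detBinom P d ∘ (fun x : Fin n → ℤ => x ∘ Equiv.swap i j) = - detBinom P d :=
    funext fun x => detBinom_swap P d i j hne x
  rw [e2, map_neg] at e
  have e3 := congrFun e x
  have e4 : x ∘ Equiv.swap i j = x := by
    ext a
    simp only [Function.comp_apply, Equiv.swap_apply_def]
    split_ifs with h1 h2
    · rw [h1, hx]
    · rw [h2, hx]
    · rfl
  rw [Function.comp_apply, e4, Pi.neg_apply, neg_eq_iff_add_eq_zero, ← two_mul] at e3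
  rw [← act_mul]
  exact (mul_eq_zero.1 e3).resolve_left two_ne_zero

/-- Setting the variable `X r` to zero. -/
def dropVar (K : Type*) [Field K] {n : ℕ} (r : Fin (n + 1)) :
    MvPolynomial (Fin (n + 1)) K →ₐ[K] MvPolynomial (Fin n) K :=
  aeval (Fin.insertNth (α := fun _ => MvPolynomial (Fin n) K) r 0 X)

theorem dropVar_X_self {n : ℕ} (r : Fin (n + 1)) : dropVar K r (X r) = 0 := by
  simp [dropVar]

theorem dropVar_X_succAbove {n : ℕ} (r : Fin (n + 1)) (i : Fin n) :
    dropVar K r (X (r.succAbove i)) = X i := by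
  simp [dropVar]

/-- The function does not depend on `k r`, so the difference in that variable annihilates it. -/
theorem act_comp_succAbove (P : K) {n : ℕ} (r : Fin (n + 1)) (p : MvPolynomial (Fin (n + 1)) K)
    (F : (Fin n → ℤ) → K) :
    act P p (F ∘ fun k : Fin (n + 1) → ℤ => k ∘ r.succAbove)
      = act P (dropVar K r p) F ∘ fun k : Fin (n + 1) → ℤ => k ∘ r.succAbove := by
  refine act_comp P _ _ (fun i F => ?_) p F
  ext k
  rcases Fin.eq_self_or_eq_succAbove r i with rfl | ⟨i, rfl⟩
  · rw [dropVar_X_self, map_zero]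
    have : Function.update k i (k i + 1) ∘ i.succAbove = k ∘ i.succAbove := by
      ext a
      simp
    simp [pDelta, shift, this]
  · rw [dropVar_X_succAbove, act_X]
    simp only [pDelta, shift, Function.comp_apply]
    rw [Function.update_comp_eq_of_injective _ Fin.succAbove_right_injective]

theorem dropVar_factorPoly_left (R : ℕ) (Q : K) (S : Finset (ℤ × ℤ)) (f : S → K) {n : ℕ}
    (r : Fin (n + 1)) (i : Fin n) :
    dropVar K r (factorPoly R Q S f r (r.succAbove i)) = C Q * shiftFactor Q i := by
  simp only [factorPoly, shiftFactor, idFactor, map_sub, map_mul, map_add, dropVar_X_self,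
    dropVar_X_succAbove, ← algebraMap_eq, AlgHom.commutes]
  ring

theorem dropVar_factorPoly_right (R : ℕ) (Q : K) (S : Finset (ℤ × ℤ)) (f : S → K) {n : ℕ}
    (r : Fin (n + 1)) (i : Fin n) :
    dropVar K r (factorPoly R Q S f (r.succAbove i) r) = C Q * idFactor Q i := by
  simp only [factorPoly, shiftFactor, idFactor, map_sub, map_mul, map_add, dropVar_X_self,
    dropVar_X_succAbove, ← algebraMap_eq, AlgHom.commutes]
  ring

theorem dropVar_factorPoly (R : ℕ) (Q : K) (S : Finset (ℤ × ℤ)) (f : S → K) {n : ℕ}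
    (r : Fin (n + 1)) (i j : Fin n) :
    dropVar K r (factorPoly R Q S f (r.succAbove i) (r.succAbove j)) = factorPoly R Q S f i j := by
  simp only [factorPoly, shiftFactor, idFactor, laurentPoly, map_sub, map_mul, map_add, map_sum,
    ← Polynomial.aeval_algHom_apply, dropVar_X_succAbove, ← algebraMap_eq, AlgHom.commutes]

/-- At `X r = 0` the mixed term of each factor involving `r` disappears. Positions before `r` leave
`Q * idFactor`, those after it leave `Q * shiftFactor`: this is where `splitFactor` comes from. -/
theorem dropVar_pairProd (R : ℕ) (Q : K) (S : Finset (ℤ × ℤ)) (f : S → K) {n : ℕ}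
    (r : Fin (n + 1)) :
    dropVar K r (pairProd R Q S f (n + 1)) = C (Q ^ n) * (splitFactor Q r * pairProd R Q S f n) := by
  rw [pairProd, Fin.prod_univ_succAbove _ r, Fin.prod_univ_succAbove _ r, if_neg (lt_irrefl r),
    one_mul]
  simp only [Fin.prod_univ_succAbove _ r, Finset.prod_mul_distrib, map_mul, map_prod]
  rw [← mul_assoc, ← mul_assoc, splitFactor, ← Finset.prod_mul_distrib]
  congr 1
  · have : (C (Q ^ n) : MvPolynomial (Fin n) K) = ∏ _i : Fin n, C Q := by simp
    rw [this, ← Finset.prod_mul_distrib]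
    refine Finset.prod_congr rfl fun i _ => ?_
    rcases lt_or_ge i.castSucc r with h | h
    · have h1 : r.succAbove i < r := by rwa [Fin.succAbove_lt_iff_castSucc_lt]
      rw [if_neg h1.asymm, if_pos h1, if_pos h, map_one, one_mul, dropVar_factorPoly_right]
    · have h1 : r < r.succAbove i := by rwa [Fin.lt_succAbove_iff_le_castSucc]
      rw [if_pos h1, if_neg h1.asymm, if_neg h.not_gt, map_one, mul_one, dropVar_factorPoly_left]
  · rw [pairProd]
    refine Finset.prod_congr rfl fun i _ => Finset.prod_congr rfl fun j _ => ?_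
    simp only [Fin.succAbove_lt_succAbove_iff]
    split_ifs
    · rw [dropVar_factorPoly]
    · rw [map_one]

end Product

/-! ### The operator formula by induction on the number of variables -/

section OperatorFormula

open MvPolynomial

/-- The lower indices of the `P`-binomial coefficients in `binomDet`. -/
def binomIndex (n m : ℕ) (j : Fin n) : ℕ := (j : ℕ) + if (j : ℕ) + 1 = n then m else 0

theorem binomDet_eq (P : K) (n m : ℕ) : binomDet P n m = detBinom P (binomIndex n m) := rfl

theorem binomIndex_lt (n m : ℕ) (j : Fin n) : binomIndex n m j < n + m := by
  unfold binomIndex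
  split_ifs <;> omega

/-- Raising all indices by one and prepending `0` keeps the jump `m` in the last column, so the same
family of determinants serves every step of the induction. -/
theorem cons_binomIndex (n m : ℕ) :
    Fin.cons (α := fun _ => ℕ) 0 (fun j => binomIndex (n + 1) m j + 1) = binomIndex (n + 2) m := by
  ext j
  refine Fin.cases ?_ (fun j => ?_) j
  · simp [binomIndex]
  · simp [binomIndex]
    split_ifs <;> omega

theorem sum_binomIndex (n m : ℕ) :
    ∑ j, binomIndex (n + 1) m j = (n + 1).choose 2 + m := by
  rw [Fin.sum_univ_castSucc]
  have : ∀ j : Fin n, binomIndex (n + 1) m j.castSucc = j := fun j => by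
    have := j.2
    simp [binomIndex]
    omega
  simp only [this, Fin.sum_univ_eq_sum_range (fun i => i), Finset.sum_range_id]
  simp [binomIndex, Nat.choose_succ_succ' n 1, ← Nat.choose_two_right]
  omega

theorem act_X_pow_binomDet (P : K) (hP : P ≠ 0) (n m R : ℕ) (hR : n + m ≤ R) (s : Fin n) :
    act P (X s ^ R) (binomDet P n m) = 0 := by
  rw [binomDet_eq]
  exact act_X_pow_detBinom P hP _ R (fun j => (binomIndex_lt n m j).trans_le hR) s

theorem alpha_eq_act [CharZero K] (P Q : K) (hP : P ≠ 0) (hQ : Q ≠ 0) (m : ℕ)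
    (S : Finset (ℤ × ℤ)) (f : S → K) (R : ℕ) (n : ℕ) (hR : n + 1 + m ≤ R) :
    alpha P Q m S f (n + 1)
      = (P ^ (((n + 1).choose 3 : ℤ) + m * n) * Q ^ (-((n + 1).choose 2 : ℤ))) •
        act P (pairProd R Q S f (n + 1)) (binomDet P (n + 1) m) := by
  induction n with
  | zero =>
    have : pairProd R Q S f (0 + 1) = 1 := by simp [pairProd]
    rw [this, act_one]
    ext k
    simp [alpha, binomDet, Nat.choose]
  | succ n ih =>
    set c : K := P ^ (((n + 1).choose 3 : ℤ) + m * n) * Q ^ (-((n + 1).choose 2 : ℤ)) with hc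
    set e : K := P ^ (∑ j, (binomIndex (n + 1) m j : ℤ)) with he
    set D : (Fin (n + 1) → ℤ) → K := detBinom P fun j => binomIndex (n + 1) m j + 1 with hD
    set H : (Fin (n + 1) → ℤ) → K := act P (pairProd R Q S f (n + 1)) D with hH
    -- The scalar `e` undoes the power of `P` lost when the lower indices of `D` are lowered.
    have hA : alpha P Q m S f (n + 1) = act P (∏ s, X s) ((c * e) • H) := by
      rw [ih (by omega), map_smul, hH, act_comm, hD, act_prod_X_detBinom P hP, map_smul, smul_smul,
        mul_assoc, he, ← zpow_add₀ hP, add_neg_cancel, zpow_zero, mul_one]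
      rfl
    have hN : ∀ s, act P (X s ^ R) D = 0 := fun s =>
      act_X_pow_detBinom P hP _ R (fun j => by have := binomIndex_lt (n + 1) m j; omega) s
    ext k
    rw [alpha, hA, sumOp_eq P Q hP hQ S f R]
    · have hdet : binomDet P (n + 1 + 1) m = ∑ r : Fin (n + 2), (-1 : K) ^ (r : ℕ) •
          (D ∘ fun k : Fin (n + 2) → ℤ => k ∘ r.succAbove) := by
        ext k
        rw [binomDet_eq, ← cons_binomIndex, detBinom_cons, Finset.sum_apply]
        rfl
      rw [hdet, map_sum, Pi.smul_apply, Finset.sum_apply, Finset.smul_sum]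
      refine Finset.sum_congr rfl fun r _ => ?_
      rw [map_smul, map_smul, act_comp_succAbove, dropVar_pairProd, act_mul P (C _), act_C, act_mul,
        ← hH]
      simp only [Pi.smul_apply, Function.comp_apply, smul_eq_mul]
      have h1 : (n + 1 + 1).choose 3 = (n + 1).choose 2 + (n + 1).choose 3 :=
        Nat.choose_succ_succ' _ _
      have h2 : (n + 1 + 1).choose 2 = (n + 1) + (n + 1).choose 2 := by
        rw [Nat.choose_succ_succ' _ 1, Nat.choose_one_right]
      -- The power of `P` grows by the sum of the lower indices; `Q ^ (n + 1)` is the factor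
      -- released by `dropVar_pairProd`.
      have h3 : c * e = P ^ (((n + 1 + 1).choose 3 : ℤ) + m * (n + 1 : ℕ)) *
          Q ^ (-((n + 1 + 1).choose 2 : ℤ)) * Q ^ (n + 1) := by
        rw [hc, he, ← Nat.cast_sum, sum_binomIndex, h1, h2, mul_right_comm, ← zpow_add₀ hP,
          mul_assoc, ← zpow_natCast Q (n + 1), ← zpow_add₀ hQ]
        congr 2 <;> push_cast <;> ring
      rw [h3]
      ring
    · intro s
      rw [map_smul, hH, act_comm, hN, map_zero, smul_zero]
    · intro i j hij x hx
      rw [map_smul, Pi.smul_apply, hH, hD, act_pairProd_vanish P R Q S f _ i j hij x hx, smul_zero]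

end OperatorFormula

/-! ### Evaluation of the determinant for `m = 0` -/

section Vandermonde

/-- Column operations reduce monic polynomials of degrees `0, 1, …` to powers. This covers `v = P ^
k` as well as the degenerate case `v = k`. -/
theorem binomDet_eq_prod (P : K) (n : ℕ) (k : Fin n → ℤ) (v : Fin n → K) (c : ℕ → K)
    (p : ℕ → Polynomial K) (hp : ∀ j, (p j).Monic) (hd : ∀ j, (p j).natDegree = j)
    (h : ∀ i, ∀ j < n, pBinom P (k i) j = c j * (p j).eval (v i)) :
    binomDet P n 0 k
      = (∏ j ∈ Finset.range n, c j) * ∏ i : Fin n, ∏ j ∈ Finset.Ioi i, (v j - v i) := by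
  rw [← Matrix.det_vandermonde, Matrix.det_eval_matrixOfPolynomials_eq_det_vandermonde v
    (fun j => p j) (fun j => hd j) (fun j => hp j), ← Fin.prod_univ_eq_prod_range,
    ← Matrix.det_mul_row, binomDet]
  congr 1
  ext i j
  simp [h i j j.2]

theorem prod_Ioi_eq_prod_range (n : ℕ) (g : ℕ → ℕ → K) :
    ∏ i : Fin n, ∏ j ∈ Finset.Ioi i, g i j
      = ∏ j ∈ Finset.range n, ∏ i ∈ Finset.range j, g i j := by
  have h1 : ∀ i : Fin n, ∏ j ∈ Finset.Ioi i, g i j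
      = ∏ j ∈ Finset.range n, if (i : ℕ) < j then g i j else 1 := by
    intro i
    rw [← Fin.prod_univ_eq_prod_range (fun j => if (i : ℕ) < j then g i j else 1) n,
      ← Finset.prod_filter]
    refine Finset.prod_congr ?_ fun _ _ => rfl
    ext j
    simp
  simp only [h1]
  rw [Fin.prod_univ_eq_prod_range
    (fun i => ∏ j ∈ Finset.range n, if i < j then g i j else 1) n, Finset.prod_comm]
  refine Finset.prod_congr rfl fun j hj => ?_
  rw [← Finset.prod_filter]
  refine Finset.prod_congr ?_ fun _ _ => rfl
  ext i
  simp only [Finset.mem_range, Finset.mem_filter] at *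
  omega

theorem binomDet_eq_pVandermonde (P : K) (hP : P ≠ 0) (n : ℕ)
    (hn : ∀ d : ℕ, 0 < d → d < n → P ^ d ≠ 1) (k : Fin n → ℤ) :
    binomDet P n 0 k = P ^ (n.choose 2) * pVandermonde P n k := by
  -- The indices `1, …, n` in the denominators of `pVandermonde` cost an extra `P ^ j` per column
  -- compared with the binomial denominators; together these give `P ^ n.choose 2`.
  have hden : ∀ j, ∏ i ∈ Finset.range j, (P ^ (j + 1) - P ^ (i + 1))
      = P ^ j * ∏ i ∈ Finset.range j, (P ^ i * (P ^ (i + 1) - 1)) := by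
    intro j
    have e1 : ∏ i ∈ Finset.range j, (P ^ (j + 1) - P ^ (i + 1))
        = ∏ i ∈ Finset.range j, ((P * P ^ i) * (P ^ (j - 1 - i + 1) - 1)) := by
      refine Finset.prod_congr rfl fun i hi => ?_
      rw [Finset.mem_range] at hi
      have : j + 1 = i + 1 + (j - 1 - i + 1) := by omega
      rw [this, pow_add]
      ring
    rw [e1, Finset.prod_mul_distrib, Finset.prod_range_reflect (fun i => P ^ (i + 1) - 1),
      Finset.prod_mul_distrib, Finset.prod_mul_distrib]
    simp only [Finset.prod_const, Finset.card_range]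
    ring
  rw [binomDet_eq_prod P n k (fun i => P ^ k i)
    (fun j => (∏ i ∈ Finset.range j, (P ^ i * (P ^ (i + 1) - 1)))⁻¹)
    (fun j => ∏ i ∈ Finset.range j, (Polynomial.X - Polynomial.C (P ^ i)))
    (fun j => Polynomial.monic_prod_of_monic _ _ fun i _ => Polynomial.monic_X_sub_C _)
    (fun j => by
      rw [Polynomial.natDegree_prod_of_monic _ _ fun i _ => Polynomial.monic_X_sub_C _]
      simp only [Polynomial.natDegree_X_sub_C, Finset.sum_const, Finset.card_range, smul_eq_mul,
        mul_one])]
  · have e : pVandermonde P n k = (∏ i : Fin n, ∏ j ∈ Finset.Ioi i, (P ^ k j - P ^ k i)) /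
        ∏ j ∈ Finset.range n, (P ^ j * ∏ i ∈ Finset.range j, (P ^ i * (P ^ (i + 1) - 1))) := by
      simp only [← hden]
      rw [← prod_Ioi_eq_prod_range n (fun i j => P ^ (j + 1) - P ^ (i + 1)), pVandermonde]
      simp only [Finset.prod_div_distrib]
    rw [e, Finset.prod_mul_distrib, Finset.prod_inv_distrib, Finset.prod_pow_eq_pow_sum,
      Finset.sum_range_id, ← Nat.choose_two_right]
    have : P ^ n.choose 2 ≠ 0 := pow_ne_zero _ hP
    field_simp
  · intro i j hj
    rw [pBinom_eq_div P hP j (fun d h1 h2 => hn d h1 (by omega)), Polynomial.eval_prod,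
      ← Finset.prod_inv_distrib, ← Finset.prod_mul_distrib, ← Finset.prod_div_distrib]
    refine Finset.prod_congr rfl fun a ha => ?_
    rw [Finset.mem_range] at ha
    have h1 : P ^ (a + 1) - 1 ≠ 0 := sub_ne_zero.2 (hn _ (by omega) (by omega))
    have h2 : 1 - P ^ (a + 1) ≠ 0 := sub_ne_zero.2 (hn _ (by omega) (by omega)).symm
    have h3 : P ^ a ≠ 0 := pow_ne_zero _ hP
    rw [zpow_sub₀ hP, zpow_natCast]
    simp only [Polynomial.eval_sub, Polynomial.eval_X, Polynomial.eval_C]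
    field_simp
    ring

theorem binomDet_one_eq_vandermonde [CharZero K] (n : ℕ) (k : Fin n → ℤ) :
    binomDet (1 : K) n 0 k = vandermonde K n k := by
  rw [binomDet_eq_prod 1 n k (fun i => (k i : K)) (fun j => (j.factorial : K)⁻¹)
    (fun j => descPochhammer K j) (fun j => monic_descPochhammer K j)
    (fun j => descPochhammer_natDegree K j)]
  · have hden : ∀ j, ∏ i ∈ Finset.range j, ((j : K) - (i : K)) = (j.factorial : K) := by
      intro j
      rw [← Finset.prod_range_add_one_eq_factorial, Nat.cast_prod, ← Finset.prod_range_reflect]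
      refine Finset.prod_congr rfl fun i hi => ?_
      rw [Finset.mem_range] at hi
      rw [← Nat.cast_sub (by omega)]
      congr 1
      omega
    have e : vandermonde K n k = (∏ i : Fin n, ∏ j ∈ Finset.Ioi i, ((k j : K) - k i)) /
        ∏ j ∈ Finset.range n, (j.factorial : K) := by
      simp only [← hden]
      rw [← prod_Ioi_eq_prod_range n (fun i j => (j : K) - (i : K)), vandermonde]
      simp only [Finset.prod_div_distrib]
    rw [e, Finset.prod_inv_distrib, inv_mul_eq_div]
  · intro i j _
    have h := Ring.descPochhammer_eq_factorial_smul_choose (k i) j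
    rw [← Polynomial.eval_eq_smeval, nsmul_eq_mul] at h
    have h2 : (descPochhammer K j).eval (k i : K)
        = ((j.factorial : ℤ) * Ring.choose (k i) j : ℤ) := by
      rw [← Nat.cast_id (j.factorial), ← descPochhammer_map (Int.castRingHom K),
        Polynomial.eval_intCast_map, Int.cast_id, h]
      simp
    have h3 : (j.factorial : K) ≠ 0 := Nat.cast_ne_zero.2 j.factorial_ne_zero
    rw [pBinom_one, h2]
    push_cast
    field_simp

end Vandermonde

/-! ### Monotone triangles -/

section MonotoneTriangles

open scoped Classical in
/-- The strictly increasing rows that interlace with the row `k`. -/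
def interlacing {n : ℕ} (k : Fin (n + 1) → ℤ) : Finset (Fin n → ℤ) :=
  (Fintype.piFinset fun i => Finset.Icc (k i.castSucc) (k i.succ)).filter StrictMono

theorem mem_interlacing {n : ℕ} (k : Fin (n + 1) → ℤ) (l : Fin n → ℤ) :
    l ∈ interlacing k ↔ (∀ i, k i.castSucc ≤ l i ∧ l i ≤ k i.succ) ∧ StrictMono l := by
  simp [interlacing]

theorem strictMono_snoc {n : ℕ} (l : Fin (n + 1) → ℤ) (x : ℤ) :
    StrictMono (Fin.snoc (α := fun _ => ℤ) l x : Fin (n + 2) → ℤ)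
      ↔ StrictMono l ∧ l (Fin.last n) < x := by
  rw [Fin.strictMono_iff_lt_succ, Fin.strictMono_iff_lt_succ, Fin.forall_fin_succ']
  refine and_congr (forall_congr' fun i => ?_) ?_
  · rw [Fin.snoc_castSucc, Fin.succ_castSucc, Fin.snoc_castSucc]
  · rw [Fin.snoc_castSucc, Fin.succ_last, Fin.snoc_last]

theorem snoc_mem_interlacing {n : ℕ} (k : Fin (n + 3) → ℤ) (l : Fin (n + 1) → ℤ) (x : ℤ) :
    (Fin.snoc (α := fun _ => ℤ) l x : Fin (n + 2) → ℤ) ∈ interlacing k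
      ↔ l ∈ interlacing (Fin.init k : Fin (n + 2) → ℤ) ∧ (k (Fin.last (n + 1)).castSucc ≤ x ∧
        x ≤ k (Fin.last (n + 2))) ∧ l (Fin.last n) < x := by
  rw [mem_interlacing, mem_interlacing, strictMono_snoc, Fin.forall_fin_succ']
  simp only [Fin.snoc_castSucc, Fin.snoc_last, Fin.succ_last, Fin.init, Fin.succ_castSucc]
  tauto

/-- Appending the largest admissible entry costs nothing: the preceding entry is at most the second
to last entry of `k`, which is strictly smaller. -/
theorem init_mem_interlacing {n : ℕ} (k : Fin (n + 2) → ℤ) (hk : StrictMono k) (l : Fin n → ℤ) :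
    l ∈ interlacing (Fin.init k : Fin (n + 1) → ℤ) ↔
      (Fin.snoc (α := fun _ => ℤ) l (k (Fin.last (n + 1))) : Fin (n + 1) → ℤ)
        ∈ interlacing k := by
  rcases n with _ | n
  · rw [mem_interlacing, mem_interlacing]
    have : StrictMono l := fun i => i.elim0
    have h2 : StrictMono (Fin.snoc (α := fun _ => ℤ) l (k (Fin.last (0 + 1))) : Fin 1 → ℤ) := by
      intro i j hij
      omega
    simp only [this, h2, and_true, IsEmpty.forall_iff, true_iff]
    have := hk.monotone (Fin.le_last (0 : Fin 2))
    simpa [Fin.snoc] using this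
  · rw [snoc_mem_interlacing]
    refine ⟨fun h => ⟨h, ⟨hk.monotone (Fin.le_last _), le_rfl⟩, ?_⟩, fun h => h.1⟩
    have := ((mem_interlacing _ _).1 h).1 (Fin.last n)
    exact this.2.trans_lt (hk (Fin.castSucc_lt_last _))

theorem mainTerm_one (G : ℤ → K) (a b : ℤ) (h : b ≤ a) :
    mainTerm 1 1 G a b = ∑ x ∈ Finset.Icc b a, G x := by
  have hs : ∀ x, signedSum 0 (x + 1 - 1) G = signedSum 0 (x - 1) G + G x := fun x => by
    rw [add_sub_cancel_right, signedSum_eq_add]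
  rw [mainTerm_eq 1 1 one_ne_zero one_ne_zero G (fun x => signedSum 0 (x - 1) G)
    (fun x => by simp only [one_zpow, one_mul, hs])]
  have h1 := signedSum_eq_sub G (fun x => signedSum 0 (x - 1) G) hs b a
  have h2 : signedSum b a G = ∑ x ∈ Finset.Icc b a, G x := if_pos h
  rw [← h2, signedSum_eq_add b a, h1]
  ring

theorem laurentOp_neg_one {ι : Type*} [DecidableEq ι] (P : K) (x y : ι) (F : (ι → ℤ) → K) :
    laurentOp P {((0 : ℤ), (0 : ℤ))} (fun _ => -1) x y F = -F := by
  have h0 : ∀ (s : ι) (F : (ι → ℤ) → K), pShiftPow P s 0 F = F := fun _ _ => rfl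
  rw [laurentOp, Finset.sum_coe_sort {((0 : ℤ), (0 : ℤ))}
    (fun p => (-1 : K) • pShiftPow P x p.1 (pShiftPow P y p.2 F)), Finset.sum_singleton, h0, h0,
    neg_one_smul]

/-- For strictly increasing upper index the summation operator of monotone triangles is the sum over
interlacing strictly increasing rows. -/
theorem sumOp_one_eq_sum : ∀ (n : ℕ) (A : (Fin n → ℤ) → K) (k : Fin (n + 1) → ℤ)
    (_ : StrictMono k),
    sumOp 1 1 {((0 : ℤ), (0 : ℤ))} (fun _ => -1) n A k = ∑ l ∈ interlacing k, A l
  | 0, A, k, _ => by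
    have : interlacing k = {![]} := by
      ext l
      rw [mem_interlacing, Finset.mem_singleton]
      exact ⟨fun _ => Subsingleton.elim _ _, fun _ => ⟨fun i => i.elim0, fun i => i.elim0⟩⟩
    rw [this, Finset.sum_singleton, sumOp]
  | 1, A, k, hk => by
    rw [sumOp, mainTerm_one _ _ _ (hk.monotone (Fin.zero_le 1))]
    refine Finset.sum_bij' (fun x _ => fun _ => x) (fun l _ => l 0) ?_ ?_ ?_ ?_ ?_
    · intro x hx
      rw [mem_interlacing]
      refine ⟨fun i => ?_, fun i j hij => by omega⟩
      obtain rfl : i = 0 := Subsingleton.elim _ _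
      exact Finset.mem_Icc.1 hx
    · intro l hl
      exact Finset.mem_Icc.2 (((mem_interlacing _ _).1 hl).1 0)
    · intro x _; rfl
    · intro l _
      ext i
      rw [Subsingleton.elim i 0]
    · intro x _
      rw [sumOp]
      congr 1
  | n + 2, A, k, hk => by
    have hk1 : StrictMono (Fin.init k : Fin (n + 2) → ℤ) :=
      hk.comp (Fin.strictMono_castSucc)
    have hk2 : StrictMono (Fin.init (Fin.init k : Fin (n + 2) → ℤ) : Fin (n + 1) → ℤ) :=
      hk1.comp (Fin.strictMono_castSucc)
    rw [sumOp, mainTerm_one _ _ _ (hk.monotone (Fin.le_last _)), sumOp_one_eq_sum n _ _ hk2]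
    simp only [sumOp_one_eq_sum (n + 1) _ _ hk1, laurentOp_neg_one, Pi.neg_apply,
      Matrix.cons_val_zero, Matrix.cons_val_one, Finset.sum_neg_distrib]
    -- The first term chooses the last entry independently of the others. Pairs with a strict last
    -- step are the rows wanted; the rest must equal the subtracted second term.
    rw [← sub_eq_add_neg, sub_eq_iff_eq_add, ← Finset.sum_product',
      ← Finset.sum_filter_add_sum_filter_not _
        (fun p : ℤ × (Fin (n + 1) → ℤ) => p.2 (Fin.last n) < p.1)]
    congr 1
    · refine Finset.sum_bij' (fun p _ => Fin.snoc (α := fun _ => ℤ) p.2 p.1)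
        (fun l _ => (l (Fin.last (n + 1)), Fin.init l)) ?_ ?_ ?_ ?_ ?_
      · rintro ⟨x, l⟩ h
        rw [Finset.mem_filter, Finset.mem_product, Finset.mem_Icc] at h
        rw [snoc_mem_interlacing]
        exact ⟨h.1.2, h.1.1, h.2⟩
      · intro l hl
        rw [← Fin.snoc_init_self l, snoc_mem_interlacing] at hl
        rw [Finset.mem_filter, Finset.mem_product, Finset.mem_Icc]
        exact ⟨⟨hl.2.1, hl.1⟩, hl.2.2⟩
      · rintro ⟨x, l⟩ _
        simp
      · intro l _
        exact Fin.snoc_init_self l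
      · intro p _
        rfl
    -- The last two entries lie on opposite sides of the second to last entry of `k`, so failing to
    -- increase strictly forces both to equal it.
    · have key : ∀ p : ℤ × (Fin (n + 1) → ℤ), p ∈ (Finset.Icc (k (Fin.last (n + 1)).castSucc)
          (k (Fin.last (n + 2))) ×ˢ interlacing (Fin.init k : Fin (n + 2) → ℤ)).filter
            (fun p => ¬ p.2 (Fin.last n) < p.1) →
          p.1 = k (Fin.last (n + 1)).castSucc ∧
            p.2 (Fin.last n) = k (Fin.last (n + 1)).castSucc := by
        rintro ⟨x, l⟩ h
        rw [Finset.mem_filter, Finset.mem_product, Finset.mem_Icc, mem_interlacing] at h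
        have h1 : l (Fin.last n) ≤ k (Fin.last (n + 1)).castSucc := (h.1.2.1 (Fin.last n)).2
        have h2 := h.1.1.1
        have h3 := h.2
        simp only at h2 h3 ⊢
        omega
      have h1 : (Fin.init k : Fin (n + 2) → ℤ) (Fin.last (n + 1)) = k (Fin.last (n + 1)).castSucc :=
        rfl
      refine Finset.sum_bij' (fun p _ => (Fin.init p.2 : Fin n → ℤ))
        (fun l _ => (k (Fin.last (n + 1)).castSucc,
          Fin.snoc (α := fun _ => ℤ) l (k (Fin.last (n + 1)).castSucc))) ?_ ?_ ?_ ?_ ?_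
      · intro p hp
        have hp' := (key p hp).2
        rw [Finset.mem_filter, Finset.mem_product] at hp
        rw [init_mem_interlacing _ hk1, h1, ← hp', Fin.snoc_init_self]
        exact hp.1.2
      · intro l hl
        rw [init_mem_interlacing _ hk1, h1] at hl
        rw [Finset.mem_filter, Finset.mem_product, Finset.mem_Icc]
        exact ⟨⟨⟨le_rfl, hk.monotone (Fin.le_last _)⟩, hl⟩, by simp⟩
      · intro p hp
        obtain ⟨e1, e2⟩ := key p hp
        refine Prod.ext e1.symm ?_
        change Fin.snoc (α := fun _ => ℤ) (Fin.init p.2) (k (Fin.last (n + 1)).castSucc) = p.2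
        rw [← e2, Fin.snoc_init_self]
      · intro l _
        simp
      · intro p hp
        obtain ⟨e1, e2⟩ := key p hp
        congr 1
        rw [e1]
        congr 1
        rw [← e2, Fin.snoc_init_self]

/-- The indices of a triangle with `n` rows. -/
abbrev TriIndex (n : ℕ) : Type := {p : Fin n × Fin n // p.1 ≤ p.2}

/-- The indices of a triangle without its bottom row. -/
def TriIndex.shift {n : ℕ} (p : TriIndex n) : TriIndex (n + 1) :=
  ⟨(p.1.1.succ, p.1.2.succ), Fin.succ_le_succ_iff.2 p.2⟩

theorem TriIndex.eq_shift {n : ℕ} (p : TriIndex (n + 1)) (h : p.1.1 ≠ 0) :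
    ∃ q : TriIndex n, p = q.shift := by
  obtain ⟨⟨i, j⟩, hij⟩ := p
  have hj : j ≠ 0 := fun hj => h (by simpa [hj] using hij)
  obtain ⟨i, rfl⟩ := Fin.exists_succ_eq.2 h
  obtain ⟨j, rfl⟩ := Fin.exists_succ_eq.2 hj
  exact ⟨⟨(i, j), Fin.succ_le_succ_iff.1 hij⟩, rfl⟩

theorem TriIndex.shift_injective {n : ℕ} : Function.Injective (TriIndex.shift (n := n)) := by
  rintro ⟨⟨i, j⟩, _⟩ ⟨⟨i', j'⟩, _⟩ h
  simpa [TriIndex.shift] using h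

open scoped Classical in
/-- The triangle obtained from `a` by adding the bottom row `k`. -/
def addRow {n : ℕ} (k : Fin (n + 1) → ℤ) (a : TriIndex n → ℤ) (p : TriIndex (n + 1)) : ℤ :=
  if h : p.1.1 ≠ 0 then a (p.eq_shift h).choose else k p.1.2

theorem addRow_shift {n : ℕ} (k : Fin (n + 1) → ℤ) (a : TriIndex n → ℤ) (p : TriIndex n) :
    addRow k a p.shift = a p := by
  have h : p.shift.1.1 ≠ 0 := Fin.succ_ne_zero _
  rw [addRow, dif_pos h]
  congr 1
  exact TriIndex.shift_injective (p.shift.eq_shift h).choose_spec.symm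

theorem addRow_zero {n : ℕ} (k : Fin (n + 1) → ℤ) (a : TriIndex n → ℤ) (p : TriIndex (n + 1))
    (h : p.1.1 = 0) : addRow k a p = k p.1.2 := by
  rw [addRow, dif_neg (not_not.2 h)]

theorem isMonotoneTriangle_addRow {n : ℕ} (k : Fin (n + 2) → ℤ) (hk : StrictMono k)
    (l : Fin (n + 1) → ℤ) (hl : l ∈ interlacing k) (a : TriIndex (n + 1) → ℤ)
    (ha : IsMonotoneTriangle l a) : IsMonotoneTriangle k (addRow k a) := by
  rw [mem_interlacing] at hl
  refine ⟨fun p q h1 h2 => ?_, fun p q h1 h2 => ?_, fun p q h1 h2 => ?_, fun p hp => ?_⟩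
  · obtain ⟨q, rfl⟩ := TriIndex.eq_shift q (fun h => by rw [h] at h1; simp at h1)
    simp only [TriIndex.shift, Fin.val_succ] at h1 h2
    rw [addRow_shift]
    by_cases hp : p.1.1 = 0
    · rw [addRow_zero _ _ _ hp, ha.bottom q (by rw [hp] at h1; simpa using h1)]
      have : p.1.2 = q.1.2.castSucc := Fin.ext (by simp; omega)
      rw [this]
      exact (hl.1 _).1
    · obtain ⟨p, rfl⟩ := TriIndex.eq_shift p hp
      simp only [TriIndex.shift, Fin.val_succ] at h1 h2
      rw [addRow_shift]
      exact ha.northeast p q (by omega) (by omega)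
  · obtain ⟨p, rfl⟩ := TriIndex.eq_shift p (fun h => by rw [h] at h1; simp at h1)
    simp only [TriIndex.shift, Fin.val_succ] at h1 h2
    rw [addRow_shift]
    by_cases hq : q.1.1 = 0
    · rw [addRow_zero _ _ _ hq, ha.bottom p (by rw [hq] at h1; simpa using h1), h2]
      exact (hl.1 _).2
    · obtain ⟨q, rfl⟩ := TriIndex.eq_shift q hq
      simp only [TriIndex.shift, Fin.val_succ] at h1 h2
      rw [addRow_shift]
      exact ha.southeast p q (by omega) (Fin.succ_injective _ h2)
  · by_cases hp : p.1.1 = 0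
    · rw [addRow_zero _ _ _ hp, addRow_zero _ _ _ (h1.trans hp)]
      exact hk (Fin.lt_def.2 (by omega))
    · obtain ⟨q, rfl⟩ := TriIndex.eq_shift q (by rwa [h1])
      obtain ⟨p, rfl⟩ := TriIndex.eq_shift p hp
      simp only [TriIndex.shift, Fin.val_succ] at h1 h2
      rw [addRow_shift, addRow_shift]
      exact ha.strict p q (Fin.succ_injective _ h1) (by omega)
  · exact addRow_zero _ _ _ (Fin.ext hp)

theorem isMonotoneTriangle_shift {n : ℕ} (k : Fin (n + 2) → ℤ) (a : TriIndex (n + 2) → ℤ)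
    (ha : IsMonotoneTriangle k a) :
    IsMonotoneTriangle
      (fun j : Fin (n + 1) => a (TriIndex.shift ⟨(0, j), Fin.zero_le j⟩)) (a ∘ TriIndex.shift) := by
  refine ⟨fun p q h1 h2 => ?_, fun p q h1 h2 => ?_, fun p q h1 h2 => ?_, fun p hp => ?_⟩
  · exact ha.northeast _ _ (by simp [TriIndex.shift, h1]) (by simp [TriIndex.shift, h2])
  · exact ha.southeast _ _ (by simp [TriIndex.shift, h1]) (by simp [TriIndex.shift, h2])
  · exact ha.strict _ _ (by simp [TriIndex.shift, h1]) (by simp [TriIndex.shift, h2])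
  · obtain ⟨⟨i, j⟩, hij⟩ := p
    obtain rfl : i = 0 := Fin.ext hp
    rfl

theorem secondRow_mem_interlacing {n : ℕ} (k : Fin (n + 2) → ℤ) (a : TriIndex (n + 2) → ℤ)
    (ha : IsMonotoneTriangle k a) :
    (fun j : Fin (n + 1) => a (TriIndex.shift ⟨(0, j), Fin.zero_le j⟩)) ∈ interlacing k := by
  rw [mem_interlacing]
  refine ⟨fun j => ⟨?_, ?_⟩, ?_⟩
  · rw [← ha.bottom ⟨(0, j.castSucc), Fin.zero_le _⟩ rfl]
    exact ha.northeast _ _ (by simp [TriIndex.shift]) (by simp [TriIndex.shift])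
  · rw [← ha.bottom ⟨(0, j.succ), Fin.zero_le _⟩ rfl]
    exact ha.southeast _ _ (by simp [TriIndex.shift]) (by simp [TriIndex.shift])
  · rw [Fin.strictMono_iff_lt_succ]
    intro j
    exact ha.strict _ _ (by simp [TriIndex.shift]) (by simp [TriIndex.shift])

/-- Removing the bottom row of a monotone triangle. -/
def monotoneTriangleEquiv {n : ℕ} (k : Fin (n + 2) → ℤ) (hk : StrictMono k) :
    {a // IsMonotoneTriangle k a} ≃ Σ l : interlacing k, {a // IsMonotoneTriangle l.1 a} where
  toFun a := ⟨⟨_, secondRow_mem_interlacing k a.1 a.2⟩, ⟨_, isMonotoneTriangle_shift k a.1 a.2⟩⟩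
  invFun x := ⟨_, isMonotoneTriangle_addRow k hk x.1.1 x.1.2 x.2.1 x.2.2⟩
  left_inv a := by
    apply Subtype.ext
    ext p
    by_cases hp : p.1.1 = 0
    · exact (addRow_zero _ _ _ hp).trans (a.2.bottom p (by simp [hp])).symm
    · obtain ⟨p, rfl⟩ := TriIndex.eq_shift p hp
      exact addRow_shift k (a.1 ∘ TriIndex.shift) p
  right_inv := by
    rintro ⟨⟨l, hl⟩, ⟨a, ha⟩⟩
    have e1 : (fun j => addRow k a (TriIndex.shift ⟨(0, j), Fin.zero_le j⟩)) = l := by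
      ext j
      rw [addRow_shift]
      exact ha.bottom _ rfl
    have e2 : addRow k a ∘ TriIndex.shift = a := funext fun p => addRow_shift k a p
    refine Sigma.ext (Subtype.ext e1) ?_
    rw [Subtype.heq_iff_coe_eq]
    · exact e2
    · intro b
      simp only [e1]

/-- Finiteness is carried through the induction because counting over the fibres with
`Nat.card_sigma` requires it. -/
theorem finite_and_card_monotoneTriangle (n : ℕ) (k : Fin (n + 1) → ℤ) (hk : StrictMono k) :
    Finite {a // IsMonotoneTriangle k a} ∧ (Nat.card {a // IsMonotoneTriangle k a} : K)
      = alpha (1 : K) 1 0 {((0 : ℤ), (0 : ℤ))} (fun _ => -1) (n + 1) k := by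
  induction n with
  | zero =>
    have hu : Unique {a // IsMonotoneTriangle k a} :=
      { default := ⟨fun p => k p.1.2, by
          refine ⟨fun p q h1 h2 => ?_, fun p q h1 h2 => ?_, fun p q h1 h2 => ?_, fun p hp => rfl⟩
            <;> omega⟩
        uniq := by
          rintro ⟨a, ha⟩
          apply Subtype.ext
          ext p
          exact ha.bottom p (by omega) }
    exact ⟨inferInstance, by simp [alpha, pBinom]⟩
  | succ n ih =>
    have hl : ∀ l : interlacing k, StrictMono l.1 := fun l => ((mem_interlacing k l.1).1 l.2).2
    have hf : ∀ l : interlacing k, Finite {a // IsMonotoneTriangle l.1 a} :=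
      fun l => (ih l.1 (hl l)).1
    refine ⟨Finite.of_equiv _ (monotoneTriangleEquiv k hk).symm, ?_⟩
    rw [Nat.card_congr (monotoneTriangleEquiv k hk), Nat.card_sigma, alpha,
      sumOp_one_eq_sum _ _ _ hk, Nat.cast_sum,
      ← Finset.sum_coe_sort (interlacing k)]
    exact Finset.sum_congr rfl fun l _ => (ih l.1 (hl l)).2

end MonotoneTriangles

/-! ### Exponents, specializations and the final statement -/

section Conclusions

open MvPolynomial

theorem six_mul_choose_three (n : ℕ) :
    6 * ((n + 1).choose 3 : ℤ) = (n + 1) * n * (n - 1) := by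
  have h2 : ∀ n : ℕ, 2 * ((n + 1).choose 2 : ℤ) = (n + 1) * n := by
    intro n
    induction n with
    | zero => simp
    | succ n ih =>
      rw [Nat.choose_succ_succ' (n + 1) 1, Nat.choose_one_right]
      push_cast
      linear_combination ih
  induction n with
  | zero => simp [Nat.choose]
  | succ n ih =>
    rw [Nat.choose_succ_succ' (n + 1) 2]
    push_cast
    linear_combination ih + 3 * h2 n

/-- The integer division is exact, so the stated exponent is the one from the induction. -/
theorem exponent_eq (n m : ℕ) :
    ((((n + 1 : ℕ) : ℤ) - 1) * (((n + 1 : ℕ) : ℤ) ^ 2 - 2 * ((n + 1 : ℕ) : ℤ) + 6 * m)) / 6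
      = ((n + 1).choose 3 : ℤ) + m * n := by
  refine Int.ediv_eq_of_eq_mul_right (by norm_num) ?_
  push_cast
  linear_combination - six_mul_choose_three n

/-- The scalar `c` lets one statement serve the determinant and both Vandermonde products; being
nonzero, it passes the annihilation on to `F`. -/
theorem alpha_eq_opProd [CharZero K] (P Q : K) (hP : P ≠ 0) (hQ : Q ≠ 0) (n m : ℕ)
    (S : Finset (ℤ × ℤ)) (f : S → K) (L : List (Fin (n + 1) × Fin (n + 1))) (hL : L.Nodup)
    (h : ∀ p, p ∈ L ↔ p.1 < p.2) (c : K) (hc : c ≠ 0) (F : (Fin (n + 1) → ℤ) → K)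
    (hF : binomDet P (n + 1) m = c • F) (k : Fin (n + 1) → ℤ) :
    alpha P Q m S f (n + 1) k
      = P ^ (((n + 1).choose 3 : ℤ) + m * n) * Q ^ (-((n + 1).choose 2 : ℤ)) *
        (c * opProd (factorOp P Q S f) L F k) := by
  have hN := act_X_pow_binomDet P hP (n + 1) m _ le_rfl
  have hF' : F = c⁻¹ • binomDet P (n + 1) m := by rw [hF, smul_smul, inv_mul_cancel₀ hc, one_smul]
  rw [opProd_factorOp_eq_act P Q (n + 1 + m) S f L F
      (fun s => by rw [hF', map_smul, hN, smul_zero]),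
    list_prod_eq_pairProd _ _ _ _ _ L hL h, alpha_eq_act P Q hP hQ m S f (n + 1 + m) n le_rfl, hF,
    map_smul]
  rfl

theorem pDelta_iterate_alpha [CharZero K] (P Q : K) (hP : P ≠ 0) (hQ : Q ≠ 0) (n m : ℕ)
    (S : Finset (ℤ × ℤ)) (f : S → K) (s : Fin (n + 1)) :
    (pDelta P s)^[n + 1 + m] (alpha P Q m S f (n + 1)) = 0 := by
  rw [← act_X_pow, alpha_eq_act P Q hP hQ m S f (n + 1 + m) n le_rfl, map_smul, act_comm,
    act_X_pow_binomDet P hP (n + 1) m _ le_rfl, map_zero, smul_zero]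

/-- Here the `PQ`-identity is the identity, and `E_t + (E_s - 1)(E_t - 1) = 1 - E_s + E_s E_t`. -/
theorem factorOp_one_one {ι : Type*} [DecidableEq ι] :
    factorOp (1 : K) 1 {((0 : ℤ), (0 : ℤ))} (fun _ => -1)
      = fun (s t : ι) F => F - shift s F + shift s (shift t F) := by
  ext s t F k
  rw [factorOp, laurentOp_neg_one]
  simp only [pqShift, pqId, pShift, pDelta, shift, one_zpow, one_smul, one_mul, Pi.add_apply,
    Pi.sub_apply, Pi.neg_apply]
  ring

end Conclusions

end OperatorFormula

end

theorem theorem3 {K : Type*} [Field K] [CharZero K] (P Q : K) (hP : P ≠ 0) (hQ : Q ≠ 0)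
    (n m : ℕ) (hn : 0 < n) (S : Finset (ℤ × ℤ)) (f : S → K) :
    -- all inverse shifts in the recursion are applied to functions for which their sum is finite
    (∀ s : Fin n, ∃ r : ℕ,
      (OperatorFormula.pDelta P s)^[r] (OperatorFormula.alpha P Q m S f n) = 0) ∧
    -- `L` lists the pairs `s < t`, in any order
    (∀ L : List (Fin n × Fin n), L.Nodup → (∀ p, p ∈ L ↔ p.1 < p.2) →
      (∀ k : Fin n → ℤ, OperatorFormula.alpha P Q m S f n k =
        P ^ ((((n : ℤ) - 1) * ((n : ℤ) ^ 2 - 2 * n + 6 * m)) / 6) * Q ^ (-(n.choose 2 : ℤ)) *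
          OperatorFormula.opProd (OperatorFormula.factorOp P Q S f) L
            (OperatorFormula.binomDet P n m) k) ∧
      ((∀ d : ℕ, 0 < d → d < n → P ^ d ≠ 1) →
        ∀ k : Fin n → ℤ, OperatorFormula.alpha P Q 0 S f n k =
          P ^ ((n + 1).choose 3) * Q ^ (-(n.choose 2 : ℤ)) *
            OperatorFormula.opProd (OperatorFormula.factorOp P Q S f) L
              (OperatorFormula.pVandermonde P n) k) ∧
      (∀ k : Fin n → ℤ, OperatorFormula.alpha 1 Q 0 S f n k =
        Q ^ (-(n.choose 2 : ℤ)) *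
          OperatorFormula.opProd (OperatorFormula.factorOp 1 Q S f) L
            (OperatorFormula.vandermonde K n) k) ∧
      (∀ k : Fin n → ℤ,
        OperatorFormula.alpha (1 : K) 1 0 {((0 : ℤ), (0 : ℤ))} (fun _ => -1) n k =
          OperatorFormula.opProd
            (fun s t F => F - OperatorFormula.shift s F
              + OperatorFormula.shift s (OperatorFormula.shift t F)) L
            (OperatorFormula.vandermonde K n) k)) ∧
    (∀ k : Fin n → ℤ, StrictMono k →
      (Nat.card {a // OperatorFormula.IsMonotoneTriangle k a} : K) =
        OperatorFormula.alpha (1 : K) 1 0 {((0 : ℤ), (0 : ℤ))} (fun _ => -1) n k) := by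
  obtain ⟨n, rfl⟩ : ∃ n', n = n' + 1 := ⟨n - 1, by omega⟩
  have h0 : ((n + 1).choose 3 : ℤ) + ((0 : ℕ) : ℤ) * n = ((n + 1).choose 3 : ℕ) := by simp
  have hone := fun (Q : K) (hQ : Q ≠ 0) (S : Finset (ℤ × ℤ)) (f : S → K) L hL h k =>
    OperatorFormula.alpha_eq_opProd (1 : K) Q one_ne_zero hQ n 0 S f L hL h 1 one_ne_zero
      (OperatorFormula.vandermonde K (n + 1))
      (by rw [one_smul]; exact funext (OperatorFormula.binomDet_one_eq_vandermonde (n + 1))) k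
  simp only [one_zpow, one_mul] at hone
  refine ⟨fun s => ⟨_, OperatorFormula.pDelta_iterate_alpha P Q hP hQ n m S f s⟩,
    fun L hL h => ⟨fun k => ?_, fun hd k => ?_, fun k => hone Q hQ S f L hL h k, fun k => ?_⟩,
    fun k hk => (OperatorFormula.finite_and_card_monotoneTriangle n k hk).2⟩
  · rw [OperatorFormula.exponent_eq, OperatorFormula.alpha_eq_opProd P Q hP hQ n m S f L hL h 1
      one_ne_zero _ (one_smul K _).symm, one_mul]
  -- The power from the induction and the one from the Vandermonde evaluation combine by Pascal's
  -- rule for binomial coefficients.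
  · rw [OperatorFormula.alpha_eq_opProd P Q hP hQ n 0 S f L hL h (P ^ (n + 1).choose 2)
      (pow_ne_zero _ hP) (OperatorFormula.pVandermonde P (n + 1))
      (funext (OperatorFormula.binomDet_eq_pVandermonde P hP (n + 1) hd)), h0, zpow_natCast,
      Nat.choose_succ_succ' (n + 1) 2, pow_add]
    ring
  · rw [hone 1 one_ne_zero _ _ L hL h k, one_zpow, one_mul, OperatorFormula.factorOp_one_one]
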